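/- Let $\mathcal X$ be a measurable space, let $R$ be a real number, let $\mathcal F\subseteq[-R,R]^{\mathcal X}$ be a bounded class of real-valued functions, and let $\gamma>0$. Call a function or a set universally measurable if it is measurable with respect to the completion of every probability measure, and assume the following measurability convention: every $f\in\mathcal F$ is universally measurable, and for every $n$ and every open $U\subseteq\mathbb R^n$ the set of those $(x_1,\dots,x_n)\in\mathcal X^n$ for which $(f(x_1),\dots,f(x_n))\in U$ for some $f\in\mathcal F$ is universally measurable (for instance, $\mathcal F$ is a countable or pointwise separable class of measurable functions, or $\mathcal X$ is countable and discrete). * For $\alpha>0$, $\mathcal F$ satisfies *$\alpha$-uniform convergence* if for all $\varepsilon,\delta>0$ there is $m$ such that for every probability distribution $q$ on $\mathcal X$ and every $n\ge m$, with probability at least $1-\delta$ over $S=(x_1,\dots,x_n)\sim q^n$, $$\sup_{f\in\mathcal F}\Bigl|\mathbb E_{x\sim q}[f(x)]-\frac1n\sum_{i=1}^n f(x_i)\Bigr|\le\alpha+\varepsilon .$$ * $\mathcal F$ is *(agnostically) $\alpha$-learnable* if there is a learner $\mathcal A$, that is, a map taking each finite sample $S$ from $\mathcal X\times[-R,R]$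 to a universally measurable hypothesis $\mathcal A_S:\mathcal X\to\mathbb R$ (not necessarily in $\mathcal F$), such that for all $\varepsilon,\delta>0$ there is $m$ such that for every probability distribution $q$ on $\mathcal X\times[-R,R]$ and every $n\ge m$, with probability at least $1-\delta$ over $S\sim q^n$, $$\mathbb E_{(x,y)\sim q}|\mathcal A_S(x)-y|\le\inf_{f\in\mathcal F}\mathbb E_{(x,y)\sim q}|f(x)-y|+\alpha+\varepsilon .$$ * The *$\alpha$-fat-shattering dimension* $\mathrm{fat}_\alpha(\mathcal F)\in\mathbb N\cup\{\infty\}$ is the supremum of all $d$ for which there are $x_1,\dots,x_d\in\mathcal X$ and $r_1,\dots,r_d\in\mathbb R$ such that for every $b\in\{\pm1\}^d$ some $f\in\mathcal F$ satisfies, for all $i$, $f(x_i)\ge r_i+\frac\alpha2$ if $b_i=+1$ and $f(x_i)\le r_i-\frac\alpha2$ if $b_i=-1$. ("With probability at least $1-\delta$" means that the failure event has outer measure at most $\delta$.) Then the following are equivalent: 1. $\mathcal F$ is $\frac\gamma2$-learnable; 2. $\mathcal F$ satisfies $\gamma$-uniform convergence; 3. $\mathrm{fat}_{\gamma'}(\mathcal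 F)<\infty$ for every $\gamma'>\gamma$. -/

import Mathlib

open MeasureTheory Set
open scoped ENNReal

noncomputable section

/-- A real function is universally measurable if it is measurable with respect to the completion
of every probability measure. In particular every measurable function is. -/
def UniversallyMeasurable {X : Type*} [MeasurableSpace X] (h : X → ℝ) : Prop :=
  ∀ q : Measure X, IsProbabilityMeasure q → AEMeasurable h q

/-- The measurability convention for a function class `F`: every `f ∈ F` is universally measurable,
and, for every `n` and every open `U ⊆ ℝⁿ`, the event that the trace
`{(f (x 0), …, f (x (n-1))) | f ∈ F}` of the class on the sample `x` meets `U` is universally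
measurable in `x ∈ Xⁿ`. Countable classes of measurable functions, pointwise separable classes,
and all classes on a countable discrete space are of this kind. -/
structure IsMeasurableClass {X : Type*} [MeasurableSpace X] (F : Set (X → ℝ)) : Prop where
  measurable_mem : ∀ f ∈ F, UniversallyMeasurable f
  measurable_trace : ∀ (n : ℕ) (U : Set (Fin n → ℝ)), IsOpen U →
    ∀ μ : Measure (Fin n → X), IsProbabilityMeasure μ →
      NullMeasurableSet {x : Fin n → X | ∃ f ∈ F, (fun i => f (x i)) ∈ U} μ

/-- The worst deviation over `F` between the expectation and the empirical mean on the sample `S`,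
`sup_{f ∈ F} |𝔼_{x ∼ q} f(x) - (1/n) ∑ f(S i)|`, as an extended nonnegative number. -/
def maxDeviation {X : Type*} [MeasurableSpace X] (F : Set (X → ℝ)) (q : Measure X)
    {n : ℕ} (S : Fin n → X) : ℝ≥0∞ :=
  ⨆ f ∈ F, ENNReal.ofReal |∫ x, f x ∂q - (∑ i, f (S i)) / n|

/-- `γ`-uniform convergence. The failure event is measured by the outer measure. -/
def UniformConvergence {X : Type*} [MeasurableSpace X] (γ : ℝ) (F : Set (X → ℝ)) : Prop :=
  ∀ ε : ℝ, 0 < ε → ∀ δ : ℝ, 0 < δ → ∃ m : ℕ,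
    ∀ q : Measure X, IsProbabilityMeasure q → ∀ n : ℕ, m ≤ n →
      Measure.pi (fun _ : Fin n => q) {S | ¬ maxDeviation F q S ≤ ENNReal.ofReal (γ + ε)}
        ≤ ENNReal.ofReal δ

/-- The expected absolute loss `𝔼_{(x,y) ∼ q} |h(x) - y|` for labels in `[-R, R]`. -/
def risk {X : Type*} [MeasurableSpace X] {R : ℝ} (q : Measure (X × Icc (-R) R)) (h : X → ℝ) :
    ℝ≥0∞ :=
  ∫⁻ p, ENNReal.ofReal |h p.1 - (p.2 : ℝ)| ∂q

/-- Agnostic `γ`-learnability with labels in `[-R, R]`. A learner maps samples of every size to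
(universally measurable) hypotheses; it need not output members of `F`.
The failure event is measured by the outer measure. -/
def Learnable {X : Type*} [MeasurableSpace X] (R γ : ℝ) (F : Set (X → ℝ)) : Prop :=
  ∃ A : (n : ℕ) → (Fin n → X × Icc (-R) R) → X → ℝ,
    (∀ n S, UniversallyMeasurable (A n S)) ∧
    ∀ ε : ℝ, 0 < ε → ∀ δ : ℝ, 0 < δ → ∃ m : ℕ,
      ∀ q : Measure (X × Icc (-R) R), IsProbabilityMeasure q → ∀ n : ℕ, m ≤ n →
        Measure.pi (fun _ : Fin n => q)
          {S | ¬ risk q (A n S) ≤ (⨅ f ∈ F, risk q f) + ENNReal.ofReal (γ + ε)}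
          ≤ ENNReal.ofReal δ

/-- `F` `γ`-shatters some `d` points. -/
def Shatters {X : Type*} (γ : ℝ) (F : Set (X → ℝ)) (d : ℕ) : Prop :=
  ∃ (x : Fin d → X) (r : Fin d → ℝ), ∀ b : Fin d → Bool, ∃ f ∈ F, ∀ i,
    (b i = true → r i + γ / 2 ≤ f (x i)) ∧ (b i = false → f (x i) ≤ r i - γ / 2)

/-- The `γ`-fat-shattering dimension; it is `⊤` iff arbitrarily large `d` are `γ`-shattered. -/
def fatDim {X : Type*} (γ : ℝ) (F : Set (X → ℝ)) : ℕ∞ :=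
  ⨆ d ∈ {d : ℕ | Shatters γ F d}, (d : ℕ∞)

end

/-! The upper bounds rest on covers in the sup norm on a finite sample. If no set of more than `d`
points is fat-shattered at scale `2 * g`, then on `n` points the class lies within `g + η` of a set
of only quasi-polynomially many centers, of size exp(O(log² n)). To see this, cut `[-R, R]` at
thresholds with spacing `η` and ask of each pair (point, threshold) whether `f` is above or below
with margin `g`, leaving the answer open in between. This is a partial binary class whose shattered
sets are fat-shattered at scale `2 * g`. A halving argument (`exists_subset_majority_eq`) compresses
every realizable labelling to O(d log n) of its constraints, and counting the thresholds predicted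
to be below the value gives a center (`exists_center`). The radius is half the fat scale up to `η`,
and this makes the constants sharp.

For uniform convergence, compare the sample with a ghost sample and exchange paired points at
random. A function enters both means, so replacing it by its center costs `2 * g`, about `γ`;
Hoeffding and a union bound control the centers (`measure_deviatingPairs_le`).

For learning, the cost is paid once. On a double sample, choose the center with least error on the
labelled half. Only the comparison of training errors with `f` costs `g`, about `γ / 2`, since the
passage from training to test error concerns the centers alone (`sum_test_error_le`). A new point is
predicted by putting it in the place of a test point; averaging over independent blocks turns
expected risk into a high-probability bound.

Conversely, take the uniform law on a shattered set much larger than the sample. A function below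
its witnesses on the sample and above them elsewhere deviates by almost `γ'`. With random labels
`±R`, any learner has loss about `R` off the sample, while the class achieves `R - γ' / 2` on
average. -/

/-! ### Halving for partial binary classes -/

section Combinatorics

variable {α : Type*} [Fintype α]

/-- The number of sets shattered by the members of a partial class that satisfy the constraints `M`.
The class is given by the family `ρ` of its realizable sets of constraints. -/
noncomputable def shatterCount (ρ : Finset (α × Bool) → Prop) (M : Finset (α × Bool)) : ℕ := by
  classical
  exact (Finset.univ.filter fun A : Finset α =>
    ∀ B : α → Bool, ρ (M ∪ A.image fun a => (a, B a))).card

open Classical in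
/-- The value at `a` keeping the larger number of shattered sets. -/
noncomputable def majority (ρ : Finset (α × Bool) → Prop) (M : Finset (α × Bool)) (a : α) : Bool :=
  decide (shatterCount ρ (insert (a, false) M) ≤ shatterCount ρ (insert (a, true) M))

open Classical in
-- A set counted on either side cannot contain `a`, whose value is already fixed. If it is counted
-- on both sides, adjoining `a` gives a further set shattered under `M`, so each set counted twice
-- is paid for by a new one.
lemma shatterCount_insert_add_le {ρ : Finset (α × Bool) → Prop}
    (hmono : ∀ C D, C ⊆ D → ρ D → ρ C)
    (hexcl : ∀ C a, (a, true) ∈ C → (a, false) ∈ C → ¬ ρ C) (M : Finset (α × Bool)) (a : α) :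
    shatterCount ρ (insert (a, true) M) + shatterCount ρ (insert (a, false) M)
      ≤ shatterCount ρ M := by
  unfold shatterCount
  set S : Finset (α × Bool) → Finset (Finset α) := fun M => Finset.univ.filter fun A : Finset α =>
    ∀ B : α → Bool, ρ (M ∪ A.image fun a => (a, B a)) with hS
  change (S _).card + (S _).card ≤ (S M).card
  have hmem : ∀ b, ∀ A ∈ S (insert (a, b) M), a ∉ A := by
    intro b A hA haA
    have h := (Finset.mem_filter.1 hA).2 (fun _ => !b)
    have h1 : (a, b) ∈ insert (a, b) M ∪ A.image fun a => (a, !b) := by simp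
    have h2 : (a, !b) ∈ insert (a, b) M ∪ A.image fun a => (a, !b) := by simp [haA]
    cases b
    · exact hexcl _ a h2 h1 h
    · exact hexcl _ a h1 h2 h
  have hsub : ∀ b, S (insert (a, b) M) ⊆ S M := by
    intro b A hA
    refine Finset.mem_filter.2 ⟨Finset.mem_univ _, fun B => ?_⟩
    refine hmono _ _ ?_ ((Finset.mem_filter.1 hA).2 B)
    exact Finset.union_subset_union (Finset.subset_insert _ _) subset_rfl
  have hins : (S (insert (a, true) M) ∩ S (insert (a, false) M)).image (insert a) ⊆ S M := by
    intro A' hA'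
    obtain ⟨A, hA, rfl⟩ := Finset.mem_image.1 hA'
    obtain ⟨h1, h0⟩ := Finset.mem_inter.1 hA
    refine Finset.mem_filter.2 ⟨Finset.mem_univ _, fun B => ?_⟩
    have key : ρ (insert (a, B a) M ∪ A.image fun a => (a, B a)) := by
      cases hB : B a
      · exact (Finset.mem_filter.1 h0).2 B
      · exact (Finset.mem_filter.1 h1).2 B
    refine hmono _ _ ?_ key
    intro p hp
    simp only [Finset.mem_union, Finset.image_insert, Finset.mem_insert] at hp ⊢
    tauto
  have hdisj : Disjoint (S (insert (a, true) M) ∪ S (insert (a, false) M))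
      ((S (insert (a, true) M) ∩ S (insert (a, false) M)).image (insert a)) := by
    rw [Finset.disjoint_left]
    intro A hA hA'
    obtain ⟨A0, -, rfl⟩ := Finset.mem_image.1 hA'
    rcases Finset.mem_union.1 hA with h | h <;> exact hmem _ _ h (Finset.mem_insert_self _ _)
  have hinj : ((S (insert (a, true) M) ∩ S (insert (a, false) M)).image (insert a)).card
      = (S (insert (a, true) M) ∩ S (insert (a, false) M)).card := by
    refine Finset.card_image_of_injOn ?_
    intro A hA A' hA' h
    have h1 := hmem _ _ (Finset.mem_inter.1 hA).1
    have h2 := hmem _ _ (Finset.mem_inter.1 hA').1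
    rw [← Finset.erase_insert h1, ← Finset.erase_insert h2]
    exact congrArg (fun s => Finset.erase s a) h
  rw [← Finset.card_union_add_card_inter, ← hinj, ← Finset.card_union_of_disjoint hdisj]
  exact Finset.card_le_card
    (Finset.union_subset (Finset.union_subset (hsub _) (hsub _)) hins)

open Classical in
lemma two_mul_shatterCount_insert_le {ρ : Finset (α × Bool) → Prop}
    (hmono : ∀ C D, C ⊆ D → ρ D → ρ C)
    (hexcl : ∀ C a, (a, true) ∈ C → (a, false) ∈ C → ¬ ρ C) (M : Finset (α × Bool)) (a : α)
    (b : Bool) (hb : majority ρ M a ≠ b) :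
    2 * shatterCount ρ (insert (a, b) M) ≤ shatterCount ρ M := by
  have h := shatterCount_insert_add_le hmono hexcl M a
  unfold majority at hb
  cases b
  · simp only [ne_eq, decide_eq_false_iff_not, not_not] at hb
    omega
  · simp only [ne_eq, decide_eq_true_eq, not_le] at hb
    omega

lemma shatterCount_pos {ρ : Finset (α × Bool) → Prop} {M : Finset (α × Bool)} (hM : ρ M) :
    0 < shatterCount ρ M := by
  classical
  exact Finset.card_pos.2 ⟨∅, by simpa using hM⟩

/-- Every realizable set of constraints is predicted by the majority vote of few of them. -/
lemma exists_subset_majority_eq {ρ : Finset (α × Bool) → Prop}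
    (hmono : ∀ C D, C ⊆ D → ρ D → ρ C)
    (hexcl : ∀ C a, (a, true) ∈ C → (a, false) ∈ C → ¬ ρ C) {Q : Finset (α × Bool)} (hQ : ρ Q) :
    ∃ M ⊆ Q, 2 ^ M.card ≤ shatterCount ρ ∅ ∧ ∀ p ∈ Q, majority ρ M p.1 = p.2 := by
  classical
  -- Take `M` of maximal size among the subsets whose count has halved at least once per constraint.
  -- A mispredicted constraint of `Q` would halve the count again and enlarge `M`.
  have hne : (Q.powerset.filter
      fun M => 2 ^ M.card * shatterCount ρ M ≤ shatterCount ρ ∅).Nonempty := ⟨∅, by simp⟩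
  obtain ⟨M, hM, hmax⟩ := Finset.exists_max_image _ Finset.card hne
  obtain ⟨hMQ, hMs⟩ := Finset.mem_filter.1 hM
  rw [Finset.mem_powerset] at hMQ
  have hpos := shatterCount_pos (hmono _ _ hMQ hQ)
  refine ⟨M, hMQ, (Nat.le_mul_of_pos_right _ hpos).trans hMs, fun p hp => ?_⟩
  by_contra hne
  have h2 := two_mul_shatterCount_insert_le hmono hexcl M p.1 p.2 hne
  have hpM : p ∉ M := by
    intro hpM
    rw [Finset.insert_eq_of_mem hpM] at h2
    omega
  have hcard := hmax (insert p M) (Finset.mem_filter.2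
    ⟨Finset.mem_powerset.2 (Finset.insert_subset hp hMQ), by
      rw [Finset.card_insert_of_notMem hpM, pow_succ, mul_assoc]
      exact (Nat.mul_le_mul_left _ h2).trans hMs⟩)
  rw [Finset.card_insert_of_notMem hpM] at hcard
  omega

/-- Such a set is listed by `d` slots, with `none` filling the unused ones. -/
lemma card_filter_card_le (α : Type*) [Fintype α] (d : ℕ) :
    (Finset.univ.filter fun A : Finset α => A.card ≤ d).card ≤ (Fintype.card α + 1) ^ d := by
  classical
  have h : (Finset.univ : Finset (Fin d → Option α)).card = (Fintype.card α + 1) ^ d := by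
    simp
  rw [← h]
  refine Finset.card_le_card_of_surjOn
    (fun g => Finset.univ.filter fun a => ∃ i, g i = some a) ?_
  intro A hA
  have hA' : A.card ≤ d := by simpa using hA
  refine ⟨fun i => if h : (i : ℕ) < A.card then some (A.equivFin.symm ⟨i, h⟩ : α) else none,
    by simp, ?_⟩
  ext a
  simp only [Finset.mem_filter, Finset.mem_univ, true_and]
  constructor
  · rintro ⟨i, hi⟩
    split_ifs at hi with h
    simp only [Option.some.injEq] at hi
    exact hi ▸ (A.equivFin.symm ⟨i, h⟩).2
  · intro ha
    refine ⟨⟨A.equivFin ⟨a, ha⟩, (A.equivFin ⟨a, ha⟩).2.trans_le hA'⟩, ?_⟩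
    simp

lemma shatterCount_empty_le {ρ : Finset (α × Bool) → Prop} {d : ℕ} [DecidableEq α]
    (hd : ∀ A : Finset α, (∀ B : α → Bool, ρ (A.image fun a => (a, B a))) → A.card ≤ d) :
    shatterCount ρ ∅ ≤ (Fintype.card α + 1) ^ d := by
  classical
  refine le_trans (Finset.card_le_card ?_) (card_filter_card_le α d)
  intro A hA
  simp only [Finset.empty_union, Finset.mem_filter, Finset.mem_univ, true_and] at hA ⊢
  refine hd A fun B => ?_
  convert hA B

end Combinatorics

/-! ### Sup-norm covers on a sample from the fat-shattering dimension -/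

section Covers

variable {X ι : Type*}

/-- The class `F` has a member whose values at the points `z` satisfy all the constraints in `C`:
the constraint `((i, j), b)` asks that the value at `z i` is above (`b = true`) or below
(`b = false`) the threshold `-R + j * η`, with margin `g`. -/
def Realizes (F : Set (X → ℝ)) (R η g : ℝ) {L : ℕ} (z : ι → X)
    (C : Finset ((ι × Fin L) × Bool)) : Prop :=
  ∃ f ∈ F, ∀ p ∈ C, (p.2 = true → -R + (p.1.2 : ℕ) * η + g < f (z p.1.1)) ∧
    (p.2 = false → f (z p.1.1) < -R + (p.1.2 : ℕ) * η - g)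

/-- The real-valued function read off from the majority votes at all thresholds. -/
noncomputable def voteCenter [Fintype ι] (R η : ℝ) {L : ℕ}
    (ρ : Finset ((ι × Fin L) × Bool) → Prop)
    (M : Finset ((ι × Fin L) × Bool)) (i : ι) : ℝ :=
  -R + η * (Finset.univ.filter fun j : Fin L => majority ρ M (i, j) = true).card

open Classical in
/-- The centers given by at most `K` constraints. -/
noncomputable def centers [Fintype ι] (R η : ℝ) {L : ℕ} (K : ℕ)
    (ρ : Finset ((ι × Fin L) × Bool) → Prop) :
    Finset (ι → ℝ) :=
  (Finset.univ.filter fun M : Finset ((ι × Fin L) × Bool) => M.card ≤ K).image (voteCenter R η ρ)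

lemma card_centers_le [Fintype ι] (R η : ℝ) {L : ℕ} (K : ℕ)
    (ρ : Finset ((ι × Fin L) × Bool) → Prop) :
    (centers R η K ρ).card ≤ (Fintype.card ι * L * 2 + 1) ^ K := by
  refine Finset.card_image_le.trans ((card_filter_card_le _ K).trans_eq ?_)
  simp

lemma centers_nonempty [Fintype ι] (R η : ℝ) {L : ℕ} (K : ℕ)
    (ρ : Finset ((ι × Fin L) × Bool) → Prop) :
    (centers R η K ρ).Nonempty := by
  classical
  exact Finset.Nonempty.image ⟨∅, by simp⟩ _

lemma mem_Icc_of_mem_centers [Fintype ι] {R η : ℝ} (hη : 0 < η) {L K : ℕ}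
    {ρ : Finset ((ι × Fin L) × Bool) → Prop} {c : ι → ℝ} (hc : c ∈ centers R η K ρ) (i : ι) :
    c i ∈ Icc (-R) (-R + L * η) := by
  classical
  obtain ⟨M, -, rfl⟩ := Finset.mem_image.1 hc
  have h : (Finset.univ.filter fun j : Fin L => majority ρ M (i, j) = true).card ≤ L :=
    (Finset.card_le_univ _).trans_eq (by simp)
  have h' : ((Finset.univ.filter fun j : Fin L => majority ρ M (i, j) = true).card : ℝ) ≤ L := by
    exact_mod_cast h
  unfold voteCenter
  constructor
  · have : 0 ≤ η * ((Finset.univ.filter fun j : Fin L => majority ρ M (i, j) = true).card : ℝ) := by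
      positivity
    linarith
  · nlinarith

/-- The thresholds satisfying `P` include all those below `v - g` and none above `v + g`. Counting
them therefore locates `v` up to `g + η`, even if `P` is not an initial segment. -/
lemma abs_sub_card_le {R η g v : ℝ} (hη : 0 < η) (hg : 0 ≤ g) {L : ℕ} (hL : 2 * R ≤ L * η)
    (hv : v ∈ Icc (-R) R) (P : Fin L → Prop) [DecidablePred P]
    (h1 : ∀ j, P j → -R + (j : ℕ) * η ≤ v + g) (h0 : ∀ j, ¬ P j → v - g ≤ -R + (j : ℕ) * η) :
    |v - (-R + η * (Finset.univ.filter P).card)| ≤ g + η := by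
  obtain ⟨hv1, hv2⟩ := hv
  set k := (Finset.univ.filter P).card with hk
  have hcast : k = ((Finset.univ.filter P).map Fin.valEmbedding).card := by simp [hk]
  have hup : k ≤ ⌊(v + R + g) / η⌋₊ + 1 := by
    rw [hcast, ← Finset.card_range (⌊(v + R + g) / η⌋₊ + 1)]
    refine Finset.card_le_card ?_
    intro n hn
    obtain ⟨j, hj, rfl⟩ := Finset.mem_map.1 hn
    have := h1 j (Finset.mem_filter.1 hj).2
    rw [Finset.mem_range, Nat.lt_succ_iff]
    refine Nat.le_floor ?_
    rw [le_div_iff₀ hη]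
    simp only [Fin.valEmbedding_apply]
    linarith
  have hlow : ⌈(v + R - g) / η⌉₊ ≤ k := by
    rw [hcast, ← Finset.card_range ⌈(v + R - g) / η⌉₊]
    refine Finset.card_le_card ?_
    intro n hn
    rw [Finset.mem_range, Nat.lt_ceil, lt_div_iff₀ hη] at hn
    -- The thresholds reach up to `R`, so none of those needed is missing.
    have hnL : n < L := by
      by_contra hcon
      push Not at hcon
      have : (L : ℝ) * η ≤ n * η := by
        have : (L : ℝ) ≤ n := by exact_mod_cast hcon
        nlinarith
      linarith
    refine Finset.mem_map.2 ⟨⟨n, hnL⟩, Finset.mem_filter.2 ⟨Finset.mem_univ _, ?_⟩, rfl⟩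
    by_contra hP
    have := h0 _ hP
    simp only at this
    linarith
  have hup' : (k : ℝ) ≤ (v + R + g) / η + 1 := by
    have : (k : ℝ) ≤ (⌊(v + R + g) / η⌋₊ : ℝ) + 1 := by exact_mod_cast hup
    have := Nat.floor_le (show 0 ≤ (v + R + g) / η from div_nonneg (by linarith) hη.le)
    linarith
  have hlow' : (v + R - g) / η ≤ k := (Nat.le_ceil _).trans (by exact_mod_cast hlow)
  rw [div_le_iff₀ hη] at hlow'
  have hup'' : (k : ℝ) * η ≤ v + R + g + η := by
    calc (k : ℝ) * η ≤ ((v + R + g) / η + 1) * η := by gcongr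
      _ = v + R + g + η := by field_simp
  rw [abs_le]
  constructor <;> nlinarith

lemma Realizes.mono {F : Set (X → ℝ)} {R η g : ℝ} {L : ℕ} {z : ι → X}
    {C D : Finset ((ι × Fin L) × Bool)} (hCD : C ⊆ D) (hD : Realizes F R η g z D) :
    Realizes F R η g z C := by
  obtain ⟨f, hf, h⟩ := hD
  exact ⟨f, hf, fun p hp => h p (hCD hp)⟩

/-- The thresholds serve as witnesses. One point may occur with several thresholds, as `Shatters`
does not ask for distinct points. -/
lemma shatters_of_realizes {F : Set (X → ℝ)} {R η g : ℝ} {L : ℕ} {z : ι → X}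
    [DecidableEq ((ι × Fin L) × Bool)] (A : Finset (ι × Fin L))
    (hA : ∀ B : ι × Fin L → Bool, Realizes F R η g z (A.image fun a => (a, B a))) :
    Shatters (2 * g) F A.card := by
  refine ⟨fun k => z (A.equivFin.symm k).1.1,
    fun k => -R + (((A.equivFin.symm k).1.2 : Fin L) : ℕ) * η, fun b => ?_⟩
  classical
  obtain ⟨f, hf, h⟩ := hA fun a => if ha : a ∈ A then b (A.equivFin ⟨a, ha⟩) else true
  refine ⟨f, hf, fun k => ?_⟩
  have := h ((A.equivFin.symm k).1, b k) (Finset.mem_image.2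
    ⟨(A.equivFin.symm k).1, (A.equivFin.symm k).2, by simp⟩)
  simp only at this
  refine ⟨fun hb => ?_, fun hb => ?_⟩
  · have := this.1 hb
    linarith
  · have := this.2 hb
    linarith

lemma exists_center [Fintype ι] {F : Set (X → ℝ)} {R η g : ℝ} (hη : 0 < η) (hg : 0 ≤ g) {L d : ℕ}
    (hL : 2 * R ≤ L * η) (hd : ∀ d', Shatters (2 * g) F d' → d' ≤ d) (z : ι → X)
    {f : X → ℝ} (hf : f ∈ F) (hfR : ∀ x, f x ∈ Icc (-R) R) :
    ∃ c ∈ centers R η (d * (Nat.log 2 (Fintype.card ι * L + 1) + 1))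
      (Realizes (L := L) F R η g z), ∀ i, |f (z i) - c i| ≤ g + η := by
  classical
  set ρ : Finset ((ι × Fin L) × Bool) → Prop := Realizes F R η g z with hρ
  have hmono : ∀ C D, C ⊆ D → ρ D → ρ C := fun C D => Realizes.mono
  have hexcl : ∀ C a, (a, true) ∈ C → (a, false) ∈ C → ¬ ρ C := by
    rintro C a h1 h0 ⟨f', -, h⟩
    have := (h _ h1).1 rfl
    have := (h _ h0).2 rfl
    simp only at *
    linarith
  -- All constraints that `f` satisfies. A threshold absent from `Q` is within `g` of the value of
  -- `f`, so either vote there is harmless.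
  set Q : Finset ((ι × Fin L) × Bool) := Finset.univ.filter fun p =>
    (p.2 = true → -R + (p.1.2 : ℕ) * η + g < f (z p.1.1)) ∧
    (p.2 = false → f (z p.1.1) < -R + (p.1.2 : ℕ) * η - g) with hQdef
  have hQ : ρ Q := ⟨f, hf, fun p hp => (Finset.mem_filter.1 hp).2⟩
  obtain ⟨M, -, hM, hmaj⟩ := exists_subset_majority_eq hmono hexcl hQ
  have hs : shatterCount ρ ∅ ≤ (Fintype.card (ι × Fin L) + 1) ^ d :=
    shatterCount_empty_le fun A hA => hd _ (shatters_of_realizes A hA)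
  have hcard : M.card ≤ d * (Nat.log 2 (Fintype.card ι * L + 1) + 1) := by
    have h1 : 2 ^ M.card ≤ 2 ^ (d * (Nat.log 2 (Fintype.card ι * L + 1) + 1)) := by
      refine (hM.trans hs).trans ?_
      rw [mul_comm d, pow_mul, Fintype.card_prod, Fintype.card_fin]
      exact Nat.pow_le_pow_left (Nat.lt_pow_succ_log_self (by norm_num) _).le _
    exact (Nat.pow_le_pow_iff_right (by norm_num)).1 h1
  refine ⟨voteCenter R η ρ M, Finset.mem_image.2 ⟨M, by simpa using hcard, rfl⟩, fun i => ?_⟩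
  refine abs_sub_card_le hη hg hL (hfR _) _ (fun j hj => ?_) (fun j hj => ?_)
  · by_contra hcon
    push Not at hcon
    have := hmaj ((i, j), false) (by simp [hQdef]; linarith)
    simp [hj] at this
  · by_contra hcon
    push Not at hcon
    have := hmaj ((i, j), true) (by simp [hQdef]; linarith)
    exact hj this

end Covers

/-! ### Hoeffding's inequality for random signs -/

section Rademacher

/-- The sign of a Boolean. -/
def boolSign (b : Bool) : ℝ := if b then 1 else -1

lemma sum_exp_boolSign_le {n : ℕ} (v : Fin n → ℝ) {B : ℝ} (hv : ∀ i, |v i| ≤ B) (l : ℝ) :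
    ∑ σ : Fin n → Bool, Real.exp (l * ∑ i, boolSign (σ i) * v i)
      ≤ 2 ^ n * Real.exp (n * (l ^ 2 * B ^ 2 / 2)) := by
  have h1 : ∀ σ : Fin n → Bool, Real.exp (l * ∑ i, boolSign (σ i) * v i)
      = ∏ i, Real.exp (l * (boolSign (σ i) * v i)) := by
    intro σ
    rw [Finset.mul_sum, Real.exp_sum]
  simp_rw [h1]
  rw [← Fintype.prod_sum (fun i (b : Bool) => Real.exp (l * (boolSign b * v i)))]
  have h2 : ∀ i, ∑ b : Bool, Real.exp (l * (boolSign b * v i))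
      ≤ 2 * Real.exp (l ^ 2 * B ^ 2 / 2) := by
    intro i
    have h := Real.cosh_le_exp_half_sq (l * v i)
    rw [Real.cosh_eq] at h
    have hB : (v i) ^ 2 ≤ B ^ 2 := sq_le_sq' (abs_le.1 (hv i)).1 (abs_le.1 (hv i)).2
    have h' : Real.exp ((l * v i) ^ 2 / 2) ≤ Real.exp (l ^ 2 * B ^ 2 / 2) := by
      apply Real.exp_le_exp.2
      rw [mul_pow]
      gcongr
    simp only [Fintype.sum_bool, boolSign, if_true, Bool.false_eq_true, if_false]
    rw [one_mul, neg_one_mul, mul_neg]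
    linarith
  calc ∏ i, ∑ b : Bool, Real.exp (l * (boolSign b * v i))
      ≤ ∏ _i : Fin n, 2 * Real.exp (l ^ 2 * B ^ 2 / 2) :=
        Finset.prod_le_prod (fun i _ => by positivity) fun i _ => h2 i
    _ = 2 ^ n * Real.exp (n * (l ^ 2 * B ^ 2 / 2)) := by
        rw [Finset.prod_const, mul_pow, ← Real.exp_nat_mul]
        simp

/-- Hoeffding's inequality for signs, as a count. -/
lemma card_boolSign_sum_gt_le {n : ℕ} (v : Fin n → ℝ) {B : ℝ} (hB : 0 < B)
    (hv : ∀ i, |v i| ≤ B) {θ : ℝ} (hθ : 0 < θ) :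
    ((Finset.univ.filter fun σ : Fin n → Bool => n * θ < ∑ i, boolSign (σ i) * v i).card : ℝ)
      ≤ 2 ^ n * Real.exp (-(θ ^ 2 / (2 * B ^ 2)) * n) := by
  -- The minimizer of the Chernoff exponent `l ^ 2 * B ^ 2 / 2 - l * θ`.
  set l := θ / B ^ 2 with hl
  have hl0 : 0 < l := by positivity
  have h := sum_exp_boolSign_le v hv l
  have h1 : ((Finset.univ.filter fun σ : Fin n → Bool =>
      n * θ < ∑ i, boolSign (σ i) * v i).card : ℝ) * Real.exp (l * (n * θ))
      ≤ ∑ σ : Fin n → Bool, Real.exp (l * ∑ i, boolSign (σ i) * v i) := by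
    rw [← nsmul_eq_mul, ← Finset.sum_const]
    refine (Finset.sum_le_sum fun σ hσ => ?_).trans
      (Finset.sum_le_sum_of_subset_of_nonneg (Finset.filter_subset _ _) fun _ _ _ => by positivity)
    exact Real.exp_le_exp.2 (mul_le_mul_of_nonneg_left (Finset.mem_filter.1 hσ).2.le hl0.le)
  rw [← le_div_iff₀ (Real.exp_pos _)] at h1
  refine h1.trans ((div_le_div_of_nonneg_right h (Real.exp_pos _).le).trans_eq ?_)
  rw [mul_div_assoc, ← Real.exp_sub]
  congr 2
  rw [hl]
  field_simp
  ring

end Rademacher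

/-! ### Quasi-polynomial against exponential growth -/

section Growth

open Filter Topology

/-- The number of centers is exp(O(log² n)), which the Hoeffding factor beats. -/
lemma tendsto_pow_log_mul_exp (a d : ℕ) {c : ℝ} (hc : 0 < c) :
    Tendsto (fun n : ℕ => ((n * a * 2 + 1 : ℕ) : ℝ) ^ (d * (Nat.log 2 (n * a + 1) + 1))
      * Real.exp (-c * n)) atTop (𝓝 0) := by
  have hlog2 : 0 < Real.log 2 := Real.log_pos (by norm_num)
  set A : ℝ := 2 * a + 1 with hA
  have hA1 : 1 ≤ A := by simp [hA]
  set κ : ℝ := d * (1 / Real.log 2 + 1) with hκ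
  -- a common bound for the logarithms of the base and of the exponent
  have hbound : ∀ n : ℕ, 3 ≤ n → ((n * a * 2 + 1 : ℕ) : ℝ) ^ (d * (Nat.log 2 (n * a + 1) + 1))
      * Real.exp (-c * n) ≤ Real.exp (κ * (Real.log (A * n)) ^ 2 - c * n) := by
    intro n hn
    have hn' : (3 : ℝ) ≤ n := by exact_mod_cast hn
    have hAn : 3 ≤ A * n := by nlinarith
    have hlogAn : 1 ≤ Real.log (A * n) := by
      rw [Real.le_log_iff_exp_le (by linarith)]
      exact Real.exp_one_lt_three.le.trans hAn
    have hbase : ((n * a * 2 + 1 : ℕ) : ℝ) ≤ A * n := by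
      push_cast
      rw [hA]
      nlinarith
    have hexp : ((d * (Nat.log 2 (n * a + 1) + 1) : ℕ) : ℝ) ≤ κ * Real.log (A * n) := by
      have h1 : (Nat.log 2 (n * a + 1) : ℝ) ≤ Real.log (A * n) / Real.log 2 := by
        refine (Real.natLog_le_logb (n * a + 1) 2).trans ?_
        rw [Real.logb]
        push_cast
        refine div_le_div_of_nonneg_right (Real.log_le_log (by positivity) ?_) hlog2.le
        rw [hA]
        have : (0 : ℝ) ≤ a := by positivity
        nlinarith
      push_cast
      rw [hκ, mul_assoc]
      refine mul_le_mul_of_nonneg_left ?_ (by positivity)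
      rw [add_mul, one_mul, one_div, inv_mul_eq_div]
      linarith
    have hpos : (0 : ℝ) < ((n * a * 2 + 1 : ℕ) : ℝ) := by positivity
    have : ((n * a * 2 + 1 : ℕ) : ℝ) ^ (d * (Nat.log 2 (n * a + 1) + 1))
        ≤ Real.exp (κ * (Real.log (A * n)) ^ 2) := by
      rw [← Real.exp_log (pow_pos hpos _), Real.log_pow]
      apply Real.exp_le_exp.2
      have h2 := Real.log_le_log hpos hbase
      have h3 : 0 ≤ κ * Real.log (A * n) := by positivity
      calc ((d * (Nat.log 2 (n * a + 1) + 1) : ℕ) : ℝ) * Real.log ((n * a * 2 + 1 : ℕ) : ℝ)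
          ≤ (κ * Real.log (A * n)) * Real.log (A * n) := by
            refine mul_le_mul hexp h2 (Real.log_nonneg ?_) h3
            exact_mod_cast Nat.le_add_left 1 _
        _ = κ * (Real.log (A * n)) ^ 2 := by ring
    calc _ ≤ Real.exp (κ * (Real.log (A * n)) ^ 2) * Real.exp (-c * n) := by gcongr
      _ = _ := by rw [← Real.exp_add]; ring_nf
  have hlim : Tendsto (fun n : ℕ => Real.exp (κ * (Real.log (A * n)) ^ 2 - c * n)) atTop (𝓝 0) := by
    refine Real.tendsto_exp_atBot.comp ?_
    have ht : Tendsto (fun n : ℕ => A * (n : ℝ)) atTop atTop :=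
      tendsto_natCast_atTop_atTop.const_mul_atTop (by linarith)
    have ho := (Real.isLittleO_pow_log_id_atTop (n := 2)).comp_tendsto ht
    have hc' : 0 < c / (2 * A * (|κ| + 1)) := by positivity
    have hev := ho.def hc'
    have hlin : Tendsto (fun n : ℕ => -(c / 2 * (n : ℝ))) atTop atBot :=
      tendsto_neg_atTop_atBot.comp (tendsto_natCast_atTop_atTop.const_mul_atTop (by positivity))
    refine tendsto_atBot_mono' _ ?_ hlin
    filter_upwards [hev] with n hn
    simp only [Function.comp, id, Real.norm_eq_abs] at hn
    rw [abs_of_nonneg (sq_nonneg _), abs_of_nonneg (show 0 ≤ A * (n : ℝ) by positivity)] at hn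
    have h1 : κ * Real.log (A * n) ^ 2 ≤ (|κ| + 1) * (c / (2 * A * (|κ| + 1)) * (A * n)) := by
      refine mul_le_mul ((le_abs_self κ).trans (by linarith)) hn (sq_nonneg _) (by positivity)
    have h2 : (|κ| + 1) * (c / (2 * A * (|κ| + 1)) * (A * n)) = c / 2 * n := by
      field_simp
    linarith
  refine squeeze_zero' (Eventually.of_forall fun n => by positivity) ?_ hlim
  filter_upwards [eventually_ge_atTop 3] with n hn using hbound n hn

end Growth

/-! ### Measurability of traces and of selections -/

section Measurability

lemma UniversallyMeasurable.comp {X Y : Type*} [MeasurableSpace X] [MeasurableSpace Y]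
    {h : Y → ℝ} (hh : UniversallyMeasurable h) {φ : X → Y} (hφ : Measurable φ) :
    UniversallyMeasurable (h ∘ φ) := fun q _ =>
  (hh (q.map φ) (Measure.isProbabilityMeasure_map hφ.aemeasurable)).comp_measurable hφ

lemma IsMeasurableClass.nullMeasurableSet_trace {X ι : Type*} [MeasurableSpace X] [Fintype ι]
    {F : Set (X → ℝ)} (hF : IsMeasurableClass F) {U : Set (ι → ℝ)} (hU : IsOpen U)
    (μ : Measure (ι → X)) [IsProbabilityMeasure μ] :
    NullMeasurableSet {x : ι → X | ∃ f ∈ F, (fun i => f (x i)) ∈ U} μ := by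
  let e := Fintype.equivFin ι
  let φ : (ι → X) → Fin (Fintype.card ι) → X := fun x k => x (e.symm k)
  have hφ : Measurable φ := measurable_pi_lambda _ fun k => measurable_pi_apply _
  have h := hF.measurable_trace (Fintype.card ι) ((fun v i => v (e i)) ⁻¹' U)
    (hU.preimage (by fun_prop)) (μ.map φ) (Measure.isProbabilityMeasure_map hφ.aemeasurable)
  have h' := h.preimage (hφ.measurePreserving μ).quasiMeasurePreserving
  convert h' using 1
  ext x
  simp [φ]

/-- The inequalities in `Realizes` are strict for this reason: realizability becomes an event
covered by the measurability convention. -/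
lemma isOpen_constraints {ι : Type*} [Finite ι] {R η g : ℝ} {L : ℕ}
    (C : Finset ((ι × Fin L) × Bool)) :
    IsOpen {v : ι → ℝ | ∀ p ∈ C, (p.2 = true → -R + (p.1.2 : ℕ) * η + g < v p.1.1) ∧
      (p.2 = false → v p.1.1 < -R + (p.1.2 : ℕ) * η - g)} := by
  simp only [ofPred_forall, ofPred_and]
  refine isOpen_biInter_finset fun p _ => IsOpen.inter ?_ ?_
  · exact isOpen_iInter_of_finite fun _ => isOpen_lt continuous_const (continuous_apply _)
  · exact isOpen_iInter_of_finite fun _ => isOpen_lt (continuous_apply _) continuous_const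

lemma IsMeasurableClass.nullMeasurableSet_realizes {X ι : Type*} [MeasurableSpace X] [Fintype ι]
    {F : Set (X → ℝ)} (hF : IsMeasurableClass F) (R η g : ℝ) {L : ℕ}
    (C : Finset ((ι × Fin L) × Bool)) (μ : Measure (ι → X)) [IsProbabilityMeasure μ] :
    NullMeasurableSet {z : ι → X | Realizes F R η g z C} μ :=
  hF.nullMeasurableSet_trace (isOpen_constraints C) μ

lemma aemeasurable_prop_of_nullMeasurableSet {Ω : Type*} [MeasurableSpace Ω] {μ : Measure Ω}
    {p : Ω → Prop} (hp : NullMeasurableSet {ω | p ω} μ) : AEMeasurable p μ := by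
  obtain ⟨t, ht, hpt⟩ := hp
  exact ⟨(· ∈ t), measurable_mem.2 ht, hpt⟩

/-- Candidates are added one at a time, each compared with the best so far on a measurable set. The
learner's choice of center has to be measurable. -/
lemma exists_measurable_argmin {E Λ : Type*} [MeasurableSpace E] [MeasurableSpace Λ]
    (err : E → Λ → ℝ) (herr : Measurable fun p : E × Λ => err p.1 p.2) {C : Finset E}
    (hC : C.Nonempty) :
    ∃ sel : Λ → E, Measurable sel ∧ ∀ l, sel l ∈ C ∧ ∀ c ∈ C, err (sel l) l ≤ err c l := by
  classical
  induction hC using Finset.Nonempty.cons_induction with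
  | singleton c => exact ⟨fun _ => c, measurable_const, by simp⟩
  | cons c C hc hC ih =>
    obtain ⟨sel, hsel, h⟩ := ih
    refine ⟨fun l => if err c l ≤ err (sel l) l then c else sel l, ?_, fun l => ?_⟩
    · refine Measurable.ite (measurableSet_le ?_ ?_) measurable_const hsel
      · exact herr.comp (measurable_const.prodMk measurable_id)
      · exact herr.comp (hsel.prodMk measurable_id)
    · simp only [Finset.mem_cons, forall_eq_or_imp]
      split_ifs with hl
      · exact ⟨Or.inl rfl, le_rfl, fun c' hc' => hl.trans ((h l).2 c' hc')⟩
      · exact ⟨Or.inr (h l).1, (not_le.1 hl).le, (h l).2⟩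

end Measurability

/-! ### Law of large numbers and symmetries of product measures -/

section ProductMeasures

open ProbabilityTheory

/-- A quantitative weak law of large numbers. -/
lemma measure_abs_mean_sub_integral_ge_le {Ω : Type*} [MeasurableSpace Ω] (μ : Measure Ω)
    [IsProbabilityMeasure μ] {W : Ω → ℝ} (hW : AEMeasurable W μ) {B : ℝ} (hB : ∀ ω, |W ω| ≤ B)
    {ε δ : ℝ} (hε : 0 < ε) {k : ℕ} (hk : 0 < k) (hkB : B ^ 2 ≤ k * ε ^ 2 * δ) :
    Measure.pi (fun _ : Fin k => μ) {ω | ε ≤ |(∑ i, W (ω i)) / k - ∫ x, W x ∂μ|}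
      ≤ ENNReal.ofReal δ := by
  have hk' : (0 : ℝ) < k := by exact_mod_cast hk
  have hmem : MemLp W 2 μ :=
    MemLp.of_bound hW.aestronglyMeasurable B (Filter.Eventually.of_forall hB)
  have hmemi : ∀ i : Fin k, MemLp (fun ω : Fin k → Ω => W (ω i)) 2 (Measure.pi fun _ => μ) :=
    fun i => hmem.comp_measurePreserving (measurePreserving_eval (fun _ : Fin k => μ) i)
  have hsum : MemLp (∑ i : Fin k, fun ω : Fin k → Ω => W (ω i)) 2 (Measure.pi fun _ => μ) :=
    memLp_finsetSum' _ fun i _ => hmemi i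
  have hcheb := meas_ge_le_variance_div_sq hsum (c := k * ε) (by positivity)
  have hvar : Var[∑ i : Fin k, fun ω : Fin k → Ω => W (ω i); Measure.pi fun _ => μ]
      ≤ k * B ^ 2 := by
    rw [variance_sum_pi fun _ => hmem]
    have h := variance_le_sq_of_bounded (μ := μ) (a := -B) (b := B) (X := W)
      (Filter.Eventually.of_forall fun ω => abs_le.1 (hB ω)) hW
    rw [show (B - -B) / 2 = B by ring] at h
    simp only [Finset.sum_const, Finset.card_univ, Fintype.card_fin, nsmul_eq_mul]
    gcongr
  have hint : ∫ ω, (∑ i : Fin k, fun ω : Fin k → Ω => W (ω i)) ω ∂(Measure.pi fun _ => μ)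
      = k * ∫ x, W x ∂μ := by
    simp only [Finset.sum_apply]
    rw [integral_finsetSum _ fun i _ => (hmemi i).integrable (by norm_num)]
    simp only [integral_comp_eval (μ := fun _ : Fin k => μ) hW.aestronglyMeasurable]
    simp
  rw [hint] at hcheb
  refine (measure_mono fun ω hω => ?_).trans (hcheb.trans (ENNReal.ofReal_le_ofReal ?_))
  · simp only [mem_ofPred_eq, Finset.sum_apply] at hω ⊢
    have : (∑ i, W (ω i)) - k * ∫ x, W x ∂μ = k * ((∑ i, W (ω i)) / k - ∫ x, W x ∂μ) := by
      field_simp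
    rw [this, abs_mul, abs_of_pos hk']
    gcongr
  · rw [div_le_iff₀ (by positivity)]
    nlinarith [mul_le_mul_of_nonneg_left hkB hk'.le]

variable {Z : Type*} [MeasurableSpace Z] (q : Measure Z) [IsProbabilityMeasure q]

lemma measurePreserving_pi_comp {ι κ : Type*} [Fintype ι] [Fintype κ] {g : ι → κ}
    (hg : Function.Injective g) :
    MeasurePreserving (fun (w : κ → Z) i => w (g i)) (Measure.pi fun _ => q)
      (Measure.pi fun _ => q) := by
  refine ⟨by fun_prop, ?_⟩
  have h := (iIndepFun_pi (μ := fun _ : κ => q) (X := fun _ z => z)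
    fun _ => aemeasurable_id).precomp hg
  rw [iIndepFun_iff_map_fun_eq_pi_map fun i => (measurable_pi_apply _).aemeasurable] at h
  refine h.trans ?_
  congr 1
  ext1 i
  exact (measurePreserving_eval (fun _ : κ => q) (g i)).map_eq

/-- Resampling one coordinate keeps the law; this lets a fresh point stand in for a test point. -/
lemma measurePreserving_update {ι : Type*} [Fintype ι] [DecidableEq ι] (i : ι) :
    MeasurePreserving (fun p : (ι → Z) × Z => Function.update p.1 i p.2)
      ((Measure.pi fun _ => q).prod q) (Measure.pi fun _ => q) := by
  have hm : Measurable fun p : (ι → Z) × Z => Function.update p.1 i p.2 := by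
    refine measurable_pi_lambda _ fun j => ?_
    by_cases h : j = i
    · subst h
      simpa using measurable_snd
    · simp only [Function.update_of_ne h]
      fun_prop
  refine ⟨hm, (Measure.pi_eq fun s hs => ?_).symm⟩
  rw [Measure.map_apply hm (MeasurableSet.univ_pi hs)]
  have : (fun p : (ι → Z) × Z => Function.update p.1 i p.2) ⁻¹' univ.pi s
      = univ.pi (Function.update s i univ) ×ˢ s i := by
    ext p
    simp only [mem_preimage, mem_univ_pi, mem_prod]
    constructor
    · intro h
      refine ⟨fun j => ?_, by simpa using h i⟩
      by_cases hj : j = i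
      · subst hj; simp
      · simpa [Function.update_of_ne hj] using h j
    · rintro ⟨h1, h2⟩ j
      by_cases hj : j = i
      · subst hj; simpa using h2
      · simpa [Function.update_of_ne hj] using h1 j
  rw [this, Measure.prod_prod, Measure.pi_pi,
    ← Finset.prod_erase_mul Finset.univ (fun j => q (s j)) (Finset.mem_univ i),
    ← Finset.prod_erase_mul Finset.univ _ (Finset.mem_univ i)]
  congr 1
  rw [Function.update_self, measure_univ, mul_one]
  exact Finset.prod_congr rfl fun j hj => by rw [Function.update_of_ne (Finset.ne_of_mem_erase hj)]

/-- A long sample is a sequence of independent blocks. -/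
lemma measurePreserving_curry (ι κ : Type*) [Fintype ι] [Fintype κ] :
    MeasurePreserving (fun (w : κ × ι → Z) k i => w (k, i)) (Measure.pi fun _ => q)
      (Measure.pi fun _ => Measure.pi fun _ => q) := by
  have h := Measure.infinitePi_map_curry (fun (_ : κ) (_ : ι) => q)
  simp only [Measure.infinitePi_eq_pi] at h
  exact ⟨by fun_prop, h⟩

lemma measurePreserving_pair (n : ℕ) :
    MeasurePreserving (fun (p : (Fin n → Z) × (Fin n → Z)) (i : Fin n × Bool) =>
        if i.2 then p.1 i.1 else p.2 i.1)
      ((Measure.pi fun _ => q).prod (Measure.pi fun _ => q)) (Measure.pi fun _ => q) := by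
  let g : Fin n × Bool → Fin n ⊕ Fin n := fun i => if i.2 then Sum.inl i.1 else Sum.inr i.1
  have hg : Function.Injective g := by
    rintro ⟨i, _ | _⟩ ⟨j, _ | _⟩ h <;> simp [g] at h ⊢ <;> exact h
  have h := (measurePreserving_pi_comp q hg).comp
    (measurePreserving_sumPiEquivProdPi_symm (X := fun _ : Fin n ⊕ Fin n => Z) fun _ => q)
  convert h using 1
  ext p ⟨i, _ | _⟩ <;> rfl

/-- Averaging over the exchanges of paired coordinates. -/
lemma measurePreserving_exchange {n : ℕ} (σ : Fin n → Bool) :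
    MeasurePreserving (fun (w : Fin n × Bool → Z) (i : Fin n × Bool) => w (i.1, xor i.2 (σ i.1)))
      (Measure.pi fun _ => q) (Measure.pi fun _ => q) := by
  refine measurePreserving_pi_comp q (g := fun i : Fin n × Bool => (i.1, xor i.2 (σ i.1))) ?_
  rintro ⟨i, b⟩ ⟨j, c⟩ h
  simp only [Prod.mk.injEq] at h ⊢
  obtain ⟨rfl, h⟩ := h
  exact ⟨rfl, by simpa using h⟩

end ProductMeasures

/-! ### Symmetrization and uniform convergence -/

section Symmetrization

lemma card_exists_boolSign_sum_gt_le {n : ℕ} {E : Type*} (V : Finset E) (v : E → Fin n → ℝ)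
    {B : ℝ} (hB : 0 < B) (hv : ∀ c ∈ V, ∀ i, |v c i| ≤ B) {θ : ℝ} (hθ : 0 < θ)
    [DecidablePred fun σ : Fin n → Bool => ∃ c ∈ V, n * θ < ∑ i, boolSign (σ i) * v c i] :
    ((Finset.univ.filter fun σ : Fin n → Bool =>
        ∃ c ∈ V, n * θ < ∑ i, boolSign (σ i) * v c i).card : ℝ)
      ≤ V.card * (2 ^ n * Real.exp (-(θ ^ 2 / (2 * B ^ 2)) * n)) := by
  classical
  have hsub : (Finset.univ.filter fun σ : Fin n → Bool =>
        ∃ c ∈ V, n * θ < ∑ i, boolSign (σ i) * v c i)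
      ⊆ V.biUnion fun c => Finset.univ.filter fun σ : Fin n → Bool =>
        n * θ < ∑ i, boolSign (σ i) * v c i := by
    intro σ hσ
    simpa using hσ
  calc _ ≤ ((∑ c ∈ V, (Finset.univ.filter fun σ : Fin n → Bool =>
        n * θ < ∑ i, boolSign (σ i) * v c i).card : ℕ) : ℝ) := by
        exact_mod_cast (Finset.card_le_card hsub).trans Finset.card_biUnion_le
    _ ≤ ∑ _c ∈ V, 2 ^ n * Real.exp (-(θ ^ 2 / (2 * B ^ 2)) * n) := by
        push_cast
        exact Finset.sum_le_sum fun c hc => card_boolSign_sum_gt_le (v c) hB (hv c hc) hθ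
    _ = _ := by rw [Finset.sum_const, nsmul_eq_mul]

variable {X : Type*} [MeasurableSpace X]

/-- Some member of `F` has means on the two halves of the sample that differ by more than `a`. -/
def deviatingPairs (F : Set (X → ℝ)) (a : ℝ) (n : ℕ) : Set (Fin n × Bool → X) :=
  {w | ∃ f ∈ F, n * a < |∑ i, (f (w (i, true)) - f (w (i, false)))|}

lemma IsMeasurableClass.nullMeasurableSet_deviatingPairs {F : Set (X → ℝ)}
    (hF : IsMeasurableClass F) (a : ℝ) (n : ℕ) (μ : Measure (Fin n × Bool → X))
    [IsProbabilityMeasure μ] : NullMeasurableSet (deviatingPairs F a n) μ :=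
  hF.nullMeasurableSet_trace
    (U := {v : Fin n × Bool → ℝ | n * a < |∑ i, (v (i, true) - v (i, false))|})
    (isOpen_lt continuous_const (by fun_prop)) μ

/-- If `f` deviates on `S` by more than `a + ε`, an independent ghost sample has its mean of `f`
within `ε` of the expectation with probability at least one half, and then the two means differ by
more than `a`. Markov's inequality for the measure of the sections gives the factor 2. -/
lemma measure_maxDeviation_gt_le {F : Set (X → ℝ)} {R : ℝ}
    (hR : ∀ f ∈ F, ∀ x, f x ∈ Icc (-R) R) (hF : IsMeasurableClass F) (q : Measure X)
    [IsProbabilityMeasure q] {a ε : ℝ} (hε : 0 < ε) {n : ℕ} (hn : 0 < n)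
    (hnR : R ^ 2 ≤ n * ε ^ 2 * (1 / 2)) :
    Measure.pi (fun _ : Fin n => q) {S | ¬ maxDeviation F q S ≤ ENNReal.ofReal (a + ε)}
      ≤ 2 * Measure.pi (fun _ => q) (deviatingPairs F a n) := by
  have hn' : (0 : ℝ) < n := by exact_mod_cast hn
  set π := Measure.pi (fun _ : Fin n => q)
  -- A measurable hull has measurable sections, so the failure event, itself perhaps not measurable,
  -- lies in a measurable set.
  set T := toMeasurable (Measure.pi fun _ => q) (deviatingPairs F a n)
  have hT : MeasurableSet T := measurableSet_toMeasurable _ _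
  have hpair := measurePreserving_pair q n
  set T' := (fun (p : (Fin n → X) × (Fin n → X)) (i : Fin n × Bool) =>
        if i.2 then p.1 i.1 else p.2 i.1) ⁻¹' T
  have hT' : MeasurableSet T' := hpair.measurable hT
  have hmeas : Measure.pi (fun _ => q) (deviatingPairs F a n) = ∫⁻ S, π (Prod.mk S ⁻¹' T') ∂π := by
    rw [← Measure.prod_apply hT', hpair.measure_preimage hT.nullMeasurableSet,
      measure_toMeasurable]
  have hfail : {S | ¬ maxDeviation F q S ≤ ENNReal.ofReal (a + ε)}
      ⊆ {S | 2⁻¹ ≤ π (Prod.mk S ⁻¹' T')} := by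
    intro S hS
    simp only [mem_ofPred_eq, maxDeviation, iSup_le_iff, not_forall, exists_prop] at hS
    obtain ⟨f, hf, hS⟩ := hS
    have hS' : a + ε < |∫ x, f x ∂q - (∑ i, f (S i)) / n| := by
      by_contra hcon
      exact hS (ENNReal.ofReal_le_ofReal (not_lt.1 hcon))
    have hlln := measure_abs_mean_sub_integral_ge_le q (hF.measurable_mem f hf q inferInstance)
      (fun x => abs_le.2 (hR f hf x)) hε hn hnR
    have hcompl : (Prod.mk S ⁻¹' T')ᶜ
        ⊆ {S' | ε ≤ |(∑ i, f (S' i)) / n - ∫ x, f x ∂q|} := by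
      intro S' hS'T
      by_contra hlt
      simp only [mem_ofPred_eq, not_le] at hlt
      refine hS'T (subset_toMeasurable _ _ ⟨f, hf, ?_⟩)
      simp only [if_true, Bool.false_eq_true, if_false, Finset.sum_sub_distrib]
      have h1 : (∑ i, f (S i)) - ∑ i, f (S' i)
          = n * ((∑ i, f (S i)) / n - (∑ i, f (S' i)) / n) := by field_simp
      rw [h1, abs_mul, abs_of_pos hn']
      refine mul_lt_mul_of_pos_left ?_ hn'
      have h2 := abs_sub_abs_le_abs_sub (∫ x, f x ∂q - (∑ i, f (S i)) / n)
        (∫ x, f x ∂q - (∑ i, f (S' i)) / n)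
      have h3 : ∫ x, f x ∂q - (∑ i, f (S i)) / n - (∫ x, f x ∂q - (∑ i, f (S' i)) / n)
        = -((∑ i, f (S i)) / n - (∑ i, f (S' i)) / n) := by ring
      rw [h3, abs_neg] at h2
      rw [abs_sub_comm] at hlt
      linarith
    have hle := (measure_univ_le_add_compl (μ := π) (Prod.mk S ⁻¹' T')).trans
      (add_le_add_right ((measure_mono hcompl).trans hlln) _)
    rw [measure_univ] at hle
    have hhalf : ENNReal.ofReal (1 / 2) = 2⁻¹ := by
      rw [one_div, ENNReal.ofReal_inv_of_pos (by norm_num)]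
      norm_num
    rw [hhalf, ← ENNReal.inv_two_add_inv_two] at hle
    exact (ENNReal.add_le_add_iff_right (by simp)).1 hle
  refine (measure_mono hfail).trans ?_
  have hmk := mul_meas_ge_le_lintegral (μ := π) (measurable_measure_prodMk_left (ν := π) hT') 2⁻¹
  rw [← hmeas] at hmk
  calc π {S | 2⁻¹ ≤ π (Prod.mk S ⁻¹' T')}
      = 2 * (2⁻¹ * π {S | 2⁻¹ ≤ π (Prod.mk S ⁻¹' T')}) := by
        rw [← mul_assoc, ENNReal.mul_inv_cancel (by simp) (by simp), one_mul]
    _ ≤ _ := by gcongr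

/-- Exchanges of pairs preserve the law, so it suffices to count, for each fixed double sample, the
exchanges that produce a deviation. Passing from `f` to its center moves each paired difference by
at most `2 * g + 2 * η`; what remains is a signed sum for one of finitely many centers. -/
lemma measure_deviatingPairs_le {F : Set (X → ℝ)} {R η g : ℝ}
    (hR : ∀ f ∈ F, ∀ x, f x ∈ Icc (-R) R) (hF : IsMeasurableClass F)
    (hη : 0 < η) (hg : 0 ≤ g) {L d : ℕ} (hL : 2 * R ≤ L * η) (hL0 : 0 < L)
    (hd : ∀ d', Shatters (2 * g) F d' → d' ≤ d) (q : Measure X)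
    [IsProbabilityMeasure q] {θ : ℝ} (hθ : 0 < θ) (n : ℕ) :
    Measure.pi (fun _ => q) (deviatingPairs F (2 * g + 2 * η + θ) n)
      ≤ ENNReal.ofReal (2 * (((n * (2 * L) * 2 + 1 : ℕ) : ℝ)
          ^ (d * (Nat.log 2 (n * (2 * L) + 1) + 1))
          * Real.exp (-(θ ^ 2 / (2 * (L * η) ^ 2)) * n))) := by
  classical
  set a := 2 * g + 2 * η + θ with ha
  set N : ℝ := ((n * (2 * L) * 2 + 1 : ℕ) : ℝ) ^ (d * (Nat.log 2 (n * (2 * L) + 1) + 1)) with hN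
  set e : ℝ := Real.exp (-(θ ^ 2 / (2 * (L * η) ^ 2)) * n) with he
  set D := deviatingPairs F a n
  have hD := hF.nullMeasurableSet_deviatingPairs a n (Measure.pi fun _ => q)
  set ex : (Fin n → Bool) → (Fin n × Bool → X) → (Fin n × Bool → X) :=
    fun σ w i => w (i.1, xor i.2 (σ i.1)) with hex
  have hexD : ∀ σ, NullMeasurableSet (ex σ ⁻¹' D) (Measure.pi fun _ => q) := fun σ =>
    hD.preimage (measurePreserving_exchange q σ).quasiMeasurePreserving
  have hB : (0 : ℝ) < L * η := mul_pos (by exact_mod_cast hL0) hη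
  -- for a fixed sample, few exchanges lead to a deviation
  have hcount : ∀ w, ((Finset.univ.filter fun σ => ex σ w ∈ D).card : ℝ)
      ≤ 2 ^ n * (2 * (N * e)) := by
    intro w
    -- The centers depend on `w` and not on the signs, as the union bound requires.
    set C := centers R η (d * (Nat.log 2 (Fintype.card (Fin n × Bool) * L + 1) + 1))
      (Realizes (L := L) F R η g w) with hC
    have hcardC : (C.card : ℝ) ≤ N := by
      have h := card_centers_le R η (d * (Nat.log 2 (Fintype.card (Fin n × Bool) * L + 1) + 1))
        (Realizes (L := L) F R η g w)
      have hc : Fintype.card (Fin n × Bool) * L = n * (2 * L) := by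
        simp [mul_assoc]
      rw [hc] at h
      rw [hN, hC, hc]
      exact_mod_cast h
    set v : (Fin n × Bool → ℝ) → Fin n → ℝ := fun c i => c (i, false) - c (i, true) with hv
    have hvB : ∀ c ∈ C, ∀ i, |v c i| ≤ L * η := by
      intro c hc i
      have h1 := mem_Icc_of_mem_centers hη hc (i, false)
      have h2 := mem_Icc_of_mem_centers hη hc (i, true)
      rw [hv, abs_le]
      constructor <;> simp only <;> linarith [h1.1, h1.2, h2.1, h2.2]
    have hvB' : ∀ c ∈ C, ∀ i, |-v c i| ≤ L * η := by simpa using hvB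
    have h1 := card_exists_boolSign_sum_gt_le C v hB hvB hθ
    have h2 := card_exists_boolSign_sum_gt_le C (fun c i => -v c i) hB hvB' hθ
    have hsub : (Finset.univ.filter fun σ => ex σ w ∈ D)
        ⊆ (Finset.univ.filter fun σ : Fin n → Bool =>
            ∃ c ∈ C, n * θ < ∑ i, boolSign (σ i) * v c i)
          ∪ (Finset.univ.filter fun σ : Fin n → Bool =>
            ∃ c ∈ C, n * θ < ∑ i, boolSign (σ i) * -v c i) := by
      intro σ hσ
      obtain ⟨f, hf, hlt⟩ := (Finset.mem_filter.1 hσ).2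
      obtain ⟨c, hc, hfc⟩ := exists_center hη hg hL hd w hf (hR f hf)
      have hsign : ∀ u : Fin n × Bool → ℝ, ∀ i,
          u (i, xor true (σ i)) - u (i, xor false (σ i))
            = boolSign (σ i) * (u (i, false) - u (i, true)) := by
        intro u i
        cases σ i <;> simp [boolSign]
      have hdiff : |∑ i, (f (ex σ w (i, true)) - f (ex σ w (i, false)))
          - ∑ i, boolSign (σ i) * v c i| ≤ n * (2 * g + 2 * η) := by
        rw [← Finset.sum_sub_distrib]
        refine (Finset.abs_sum_le_sum_abs _ _).trans ?_
        refine (Finset.sum_le_sum (g := fun _ => 2 * g + 2 * η) fun i _ => ?_).trans_eq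
          (by simp; ring)
        rw [hv, ← hsign c i]
        have e1 := abs_le.1 (hfc (i, xor true (σ i)))
        have e2 := abs_le.1 (hfc (i, xor false (σ i)))
        simp only [hex]
        rw [abs_le]
        constructor <;> linarith [e1.1, e1.2, e2.1, e2.2]
      have hgt : n * θ < |∑ i, boolSign (σ i) * v c i| := by
        have := abs_sub_abs_le_abs_sub (∑ i, (f (ex σ w (i, true)) - f (ex σ w (i, false))))
          (∑ i, boolSign (σ i) * v c i)
        have : (n : ℝ) * a = n * (2 * g + 2 * η) + n * θ := by rw [ha]; ring
        linarith
      rcases lt_abs.1 hgt with h | h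
      · exact Finset.mem_union_left _ (Finset.mem_filter.2 ⟨Finset.mem_univ _, c, hc, h⟩)
      · refine Finset.mem_union_right _ (Finset.mem_filter.2 ⟨Finset.mem_univ _, c, hc, ?_⟩)
        simpa [Finset.sum_neg_distrib] using h
    have h3 : ((Finset.univ.filter fun σ => ex σ w ∈ D).card : ℝ)
        ≤ C.card * (2 ^ n * e) + C.card * (2 ^ n * e) := by
      refine le_trans ?_ (add_le_add h1 h2)
      exact_mod_cast (Finset.card_le_card hsub).trans (Finset.card_union_le _ _)
    have h4 : (C.card : ℝ) * (2 ^ n * e) ≤ N * (2 ^ n * e) :=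
      mul_le_mul_of_nonneg_right hcardC (by positivity)
    linarith
  have hsum : (2 ^ n : ℝ≥0∞) * Measure.pi (fun _ => q) D
      ≤ 2 ^ n * ENNReal.ofReal (2 * (N * e)) := by
    calc (2 ^ n : ℝ≥0∞) * Measure.pi (fun _ => q) D
        = ∑ σ : Fin n → Bool, Measure.pi (fun _ => q) (ex σ ⁻¹' D) := by
          rw [Finset.sum_congr rfl fun σ _ =>
            (measurePreserving_exchange q σ).measure_preimage hD]
          simp [D]
      _ = ∑ σ : Fin n → Bool, ∫⁻ w, (ex σ ⁻¹' D).indicator 1 w ∂(Measure.pi fun _ => q) :=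
          Finset.sum_congr rfl fun σ _ => (lintegral_indicator_one₀ (hexD σ)).symm
      _ = ∫⁻ w, ∑ σ : Fin n → Bool, (ex σ ⁻¹' D).indicator 1 w ∂(Measure.pi fun _ => q) :=
          (lintegral_finsetSum' _ fun σ _ => aemeasurable_const.indicator₀ (hexD σ)).symm
      _ ≤ ∫⁻ _w, ENNReal.ofReal (2 ^ n * (2 * (N * e))) ∂(Measure.pi fun _ => q) := by
          refine lintegral_mono fun w => ?_
          have : ∑ σ : Fin n → Bool, (ex σ ⁻¹' D).indicator (1 : (Fin n × Bool → X) → ℝ≥0∞) w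
              = ENNReal.ofReal ((Finset.univ.filter fun σ => ex σ w ∈ D).card : ℝ) := by
            simp [Set.indicator_apply]
          rw [this]
          exact ENNReal.ofReal_le_ofReal (hcount w)
      _ = 2 ^ n * ENNReal.ofReal (2 * (N * e)) := by
          rw [lintegral_const, measure_univ, mul_one, ENNReal.ofReal_mul (by positivity)]
          norm_num
  exact (ENNReal.mul_le_mul_iff_right (by simp) (by simp)).1 hsum

lemma exists_shatters_bound_of_fatDim_lt_top {X : Type*} {γ : ℝ} {F : Set (X → ℝ)}
    (h : fatDim γ F < ⊤) : ∃ d, ∀ d', Shatters γ F d' → d' ≤ d := by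
  obtain ⟨d, hd⟩ := ENat.ne_top_iff_exists.1 h.ne
  refine ⟨d, fun d' hd' => ?_⟩
  have : (d' : ℕ∞) ≤ fatDim γ F := le_iSup₂_of_le d' hd' le_rfl
  rw [← hd] at this
  exact_mod_cast this

theorem uniformConvergence_of_fatDim_lt_top {F : Set (X → ℝ)} {R : ℝ}
    (hR : ∀ f ∈ F, ∀ x, f x ∈ Icc (-R) R) (hF : IsMeasurableClass F) {γ : ℝ} (hγ : 0 < γ)
    (hfat : ∀ γ' : ℝ, γ < γ' → fatDim γ' F < ⊤) : UniformConvergence γ F := by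
  intro ε hε δ hδ
  obtain ⟨d, hd⟩ := exists_shatters_bound_of_fatDim_lt_top (hfat (γ + ε / 4) (by linarith))
  -- The cover and the signs cost `(γ + ε / 4) + 2 * η + ε / 8 = γ + ε / 2`; the ghost sample takes
  -- the other `ε / 2`.
  set η := ε / 16 with hη
  have hη0 : 0 < η := by positivity
  -- The extra 1 keeps `L` positive for every `R`.
  set L := ⌈2 * R / η⌉₊ + 1 with hLdef
  have hL : 2 * R ≤ L * η := by
    rw [← div_le_iff₀ hη0, hLdef]
    push_cast
    linarith [Nat.le_ceil (2 * R / η)]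
  set c := (ε / 8) ^ 2 / (2 * (L * η) ^ 2) with hc
  have hc0 : 0 < c := by positivity
  have hlim := tendsto_pow_log_mul_exp (2 * L) d hc0
  have hev := (hlim.eventually (gt_mem_nhds (show (0 : ℝ) < δ / 4 by positivity)))
  obtain ⟨m₁, hm₁⟩ := Filter.eventually_atTop.1 hev
  obtain ⟨m₂, hm₂⟩ := exists_nat_ge (R ^ 2 / ((ε / 2) ^ 2 * (1 / 2)))
  refine ⟨max m₁ m₂ + 1, fun q hq n hn => ?_⟩
  have hn₁ : m₁ ≤ n := by omega
  have hn₂ : m₂ ≤ n := by omega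
  have hnR : R ^ 2 ≤ n * (ε / 2) ^ 2 * (1 / 2) := by
    rw [div_le_iff₀ (by positivity)] at hm₂
    have : (m₂ : ℝ) ≤ n := by exact_mod_cast hn₂
    nlinarith [sq_nonneg ε]
  have h1 := measure_maxDeviation_gt_le hR hF q (a := γ + ε / 2) (half_pos hε)
    (by omega) hnR
  have h2 := measure_deviatingPairs_le (g := (γ + ε / 4) / 2) hR hF hη0 (by positivity) hL
    (Nat.succ_pos _) (by rwa [mul_div_cancel₀ _ two_ne_zero]) q
    (show 0 < ε / 8 by positivity) n
  have e1 : 2 * ((γ + ε / 4) / 2) + 2 * η + ε / 8 = γ + ε / 2 := by rw [hη]; ring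
  have e2 : γ + ε / 2 + ε / 2 = γ + ε := by ring
  rw [e1] at h2
  rw [e2] at h1
  have h3 := hm₁ n hn₁
  calc _ ≤ _ := h1
    _ ≤ 2 * ENNReal.ofReal (2 * (δ / 4)) := by
        gcongr
        exact h2.trans (ENNReal.ofReal_le_ofReal (by linarith))
    _ = ENNReal.ofReal δ := by
        rw [show (2 : ℝ≥0∞) = ENNReal.ofReal 2 by norm_num, ← ENNReal.ofReal_mul (by norm_num)]
        congr 1; ring

end Symmetrization

/-! ### Necessity of finite fat-shattering dimension -/

section LowerBounds

lemma exists_shatters_ge_of_not_fatDim_lt_top {X : Type*} {γ : ℝ} {F : Set (X → ℝ)}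
    (h : ¬ fatDim γ F < ⊤) (N : ℕ) : ∃ d, N ≤ d ∧ Shatters γ F d := by
  by_contra hcon
  push Not at hcon
  refine h (lt_of_le_of_lt (b := (N : ℕ∞)) (iSup₂_le fun d hd => ?_) (ENat.natCast_lt_top N))
  by_contra hlt
  exact hcon d (by exact_mod_cast (not_le.1 hlt).le) hd

/-- The uniform distribution on `Fin d`. -/
noncomputable def uniformFin (d : ℕ) : Measure (Fin d) := (d : ℝ≥0∞)⁻¹ • Measure.count

lemma uniformFin_singleton (d : ℕ) (i : Fin d) : uniformFin d {i} = (d : ℝ≥0∞)⁻¹ := by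
  simp [uniformFin]

lemma isProbabilityMeasure_uniformFin {d : ℕ} (hd : 0 < d) :
    IsProbabilityMeasure (uniformFin d) := by
  constructor
  rw [uniformFin, Measure.smul_apply, Measure.count_univ]
  simp only [ENat.card_eq_coe_fintype_card, Fintype.card_fin, ENat.toENNReal_coe, smul_eq_mul]
  exact ENNReal.inv_mul_cancel (by exact_mod_cast hd.ne') (by simp)

lemma integral_uniformFin {d : ℕ} (hd : 0 < d) (g : Fin d → ℝ) :
    ∫ i, g i ∂(uniformFin d) = (∑ i, g i) / d := by
  have := isProbabilityMeasure_uniformFin hd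
  rw [integral_fintype (Integrable.of_finite)]
  simp [Measure.real, uniformFin_singleton, ← Finset.mul_sum, div_eq_inv_mul]

lemma lintegral_uniformFin {d : ℕ} (hd : 0 < d) (g : Fin d → ℝ) (hg : ∀ i, 0 ≤ g i) :
    ∫⁻ i, ENNReal.ofReal (g i) ∂(uniformFin d) = ENNReal.ofReal ((∑ i, g i) / d) := by
  rw [lintegral_fintype]
  simp only [uniformFin_singleton]
  rw [← Finset.sum_mul, ← ENNReal.ofReal_sum_of_nonneg fun i _ => hg i,
    ENNReal.ofReal_div_of_pos (by exact_mod_cast hd), ENNReal.ofReal_natCast, div_eq_mul_inv]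

/-- The outer measure of an event dominates the measure of its pullback to the index space. -/
lemma pi_uniformFin_preimage_le {Z : Type*} [MeasurableSpace Z] {d : ℕ} (hd : 0 < d)
    (z : Fin d → Z) (n : ℕ) (A : Set (Fin n → Z)) :
    Measure.pi (fun _ : Fin n => uniformFin d) {S | (fun j => z (S j)) ∈ A}
      ≤ Measure.pi (fun _ : Fin n => (uniformFin d).map z) A := by
  have := isProbabilityMeasure_uniformFin hd
  have hz : Measurable z := measurable_of_finite z
  have := Measure.isProbabilityMeasure_map (μ := uniformFin d) hz.aemeasurable
  have h := Measure.pi_map_pi (μ := fun _ : Fin n => uniformFin d) (f := fun _ => z)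
    fun _ => hz.aemeasurable
  rw [← h]
  exact Measure.le_map_apply (measurable_of_finite _).aemeasurable A

variable {X : Type*} [MeasurableSpace X]

/-- Under the uniform law on many shattered points, some member lies below the witnesses on the
sample and above them elsewhere. The witnesses' own empirical mean is close to their expectation, so
the deviation is nearly `γ'`. -/
theorem fatDim_lt_top_of_uniformConvergence {F : Set (X → ℝ)} {R : ℝ}
    (hR : ∀ f ∈ F, ∀ x, f x ∈ Icc (-R) R) (hF : IsMeasurableClass F) {γ : ℝ} (hγ : 0 < γ)
    (hUC : UniformConvergence γ F) {γ' : ℝ} (hγ' : γ < γ') : fatDim γ' F < ⊤ := by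
  classical
  by_contra hfat
  set κ := γ' - γ with hκ
  have hκ0 : 0 < κ := sub_pos.2 hγ'
  obtain ⟨m, hm⟩ := hUC (κ / 8) (by positivity) (1 / 4) (by norm_num)
  obtain ⟨m', hm'⟩ := exists_nat_ge (R ^ 2 / ((κ / 8) ^ 2 * (1 / 4)))
  set n := max m m' + 1 with hn
  have hn0 : (0 : ℝ) < n := by positivity
  have hnR : R ^ 2 ≤ n * (κ / 8) ^ 2 * (1 / 4) := by
    rw [div_le_iff₀ (by positivity)] at hm'
    have : (m' : ℝ) ≤ n := by exact_mod_cast (by omega : m' ≤ n)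
    nlinarith [sq_nonneg κ]
  obtain ⟨N, hN⟩ := exists_nat_ge (8 * R * n / κ)
  obtain ⟨d, hd, x, r, hsh⟩ := exists_shatters_ge_of_not_fatDim_lt_top hfat (N + 1)
  have hd0 : 0 < d := by omega
  have hd0' : (0 : ℝ) < d := by exact_mod_cast hd0
  -- At most `n` of the `d` points are sampled, and each lowers the mean by at most `2 * R / d`.
  have hdn : 2 * R * n / d ≤ κ / 4 := by
    rw [div_le_iff₀ hκ0] at hN
    rw [div_le_iff₀ hd0']
    have : (N : ℝ) ≤ d := by exact_mod_cast (by omega : N ≤ d)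
    nlinarith
  have hr₁ : ∀ i, r i + γ' / 2 ≤ R := fun i => by
    obtain ⟨f, hf, h⟩ := hsh fun _ => true
    exact ((h i).1 rfl).trans (hR f hf _).2
  have hr₂ : ∀ i, -R ≤ r i - γ' / 2 := fun i => by
    obtain ⟨f, hf, h⟩ := hsh fun _ => false
    exact (hR f hf _).1.trans ((h i).2 rfl)
  have := isProbabilityMeasure_uniformFin hd0
  have hx : Measurable x := measurable_of_finite x
  have hq := Measure.isProbabilityMeasure_map (μ := uniformFin d) hx.aemeasurable
  have hfail := (pi_uniformFin_preimage_le hd0 x n _).trans (hm _ hq n (by omega))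
  have hlln := measure_abs_mean_sub_integral_ge_le (uniformFin d)
    (measurable_of_finite r).aemeasurable (B := R)
    (fun i => abs_le.2 ⟨by linarith [hr₂ i], by linarith [hr₁ i]⟩)
    (show 0 < κ / 8 by positivity) (by omega) hnR
  -- Every sample is bad for uniform convergence or for the law of large numbers, though each event
  -- has probability at most `1 / 4`.
  have hcover : (univ : Set (Fin n → Fin d)) ⊆
      {S | (fun j => x (S j)) ∈ {S : Fin n → X |
        ¬ maxDeviation F ((uniformFin d).map x) S ≤ ENNReal.ofReal (γ + κ / 8)}}
      ∪ {S | κ / 8 ≤ |(∑ j, r (S j)) / n - ∫ i, r i ∂(uniformFin d)|} := by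
    intro S _
    by_contra hS
    simp only [mem_union, mem_ofPred_eq, not_or, not_le] at hS
    obtain ⟨hdev, hmean⟩ := hS
    obtain ⟨f, hf, hfS⟩ := hsh fun i => decide (i ∉ Set.range S)
    have h1 : |∫ y, f y ∂((uniformFin d).map x) - (∑ j, f (x (S j))) / n| ≤ γ + κ / 8 := by
      have := (le_iSup₂ (f := fun f (_ : f ∈ F) => ENNReal.ofReal
        |∫ y, f y ∂((uniformFin d).map x) - (∑ j, f (x (S j))) / n|) f hf).trans (not_lt.1 hdev)
      rwa [ENNReal.ofReal_le_ofReal_iff (by positivity)] at this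
    rw [integral_map hx.aemeasurable (hF.measurable_mem f hf _ hq).aestronglyMeasurable,
      integral_uniformFin hd0] at h1
    rw [integral_uniformFin hd0] at hmean
    have hemp : (∑ j, f (x (S j))) / n ≤ (∑ j, r (S j)) / n - γ' / 2 := by
      have : ∑ j, f (x (S j)) ≤ ∑ j, (r (S j) - γ' / 2) :=
        Finset.sum_le_sum fun j _ => (hfS (S j)).2 (by simp)
      rw [Finset.sum_sub_distrib, Finset.sum_const, Finset.card_univ, Fintype.card_fin,
        nsmul_eq_mul] at this
      rw [div_le_iff₀ hn0, sub_mul, div_mul_cancel₀ _ hn0.ne']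
      linarith
    have hmeanf : (∑ i, r i) / d + γ' / 2 - 2 * R * n / d ≤ (∑ i, f (x i)) / d := by
      have hpt : ∀ i, r i + γ' / 2 - (if i ∈ Finset.univ.image S then 2 * R else 0) ≤ f (x i) := by
        intro i
        split_ifs with hi
        · linarith [hr₁ i, (hR f hf (x i)).1]
        · have hi' : i ∉ Set.range S := by simpa using hi
          linarith [(hfS i).1 (by simpa using hi')]
      have hsum := Finset.sum_le_sum fun i (_ : i ∈ Finset.univ) => hpt i
      rw [Finset.sum_sub_distrib, Finset.sum_add_distrib, Finset.sum_ite_mem, Finset.univ_inter,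
        Finset.sum_const, Finset.sum_const, Finset.card_univ, Fintype.card_fin, nsmul_eq_mul,
        nsmul_eq_mul] at hsum
      have hc : ((Finset.univ.image S).card : ℝ) ≤ n := by
        exact_mod_cast Finset.card_image_le.trans_eq (by simp)
      have hR0 : 0 ≤ R := by linarith [hr₁ ⟨0, hd0⟩, hr₂ ⟨0, hd0⟩]
      have e : (∑ i, r i) / d + γ' / 2 - 2 * R * n / d
          = (∑ i, r i + d * (γ' / 2) - n * (2 * R)) / d := by
        field_simp
      rw [e]
      refine div_le_div_of_nonneg_right ?_ hd0'.le
      nlinarith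
    have := (abs_le.1 h1).2
    have := (abs_lt.1 hmean).2
    linarith
  have htot := (measure_mono hcover).trans ((measure_union_le _ _).trans (add_le_add hfail hlln))
  rw [measure_univ, ← ENNReal.ofReal_add (by norm_num) (by norm_num)] at htot
  have : (1 : ℝ) ≤ 1 / 4 + 1 / 4 := ENNReal.one_le_ofReal.1 htot
  norm_num at this

/-- Pairing each pattern with its flip at `i` reduces an average over all patterns to two-term sums.
-/
lemma two_pow_mul_le_sum_of_flip {d : ℕ} (i : Fin d) (G : (Fin d → Bool) → ℝ) (c : ℝ)
    (h : ∀ b, 2 * c ≤ G b + G (Function.update b i (!b i))) : 2 ^ d * c ≤ ∑ b, G b := by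
  have hinv : Function.Involutive fun b : Fin d → Bool => Function.update b i (!b i) := by
    intro b
    simp
  have h1 : ∑ b, G (Function.update b i (!b i)) = ∑ b, G b := Equiv.sum_comp hinv.toPerm G
  have h2 := Finset.sum_le_sum fun b (_ : b ∈ Finset.univ) => h b
  rw [Finset.sum_add_distrib, h1, Finset.sum_const, Finset.card_univ, nsmul_eq_mul] at h2
  simp only [Fintype.card_pi, Fintype.card_bool, Finset.prod_const, Finset.card_univ,
    Fintype.card_fin, Nat.cast_pow, Nat.cast_ofNat] at h2
  linarith

lemma aemeasurable_loss {R : ℝ} {h : X → ℝ} (hh : UniversallyMeasurable h)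
    (q : Measure (X × Icc (-R) R)) [IsProbabilityMeasure q] :
    AEMeasurable (fun p : X × Icc (-R) R => |h p.1 - (p.2 : ℝ)|) q := by
  have h1 := hh.comp (measurable_fst (α := X) (β := Icc (-R) R)) q inferInstance
  exact (h1.sub (measurable_subtype_coe.comp measurable_snd).aemeasurable).abs

lemma risk_map_uniformFin {R : ℝ} {h : X → ℝ} (hh : UniversallyMeasurable h) {d : ℕ}
    (hd : 0 < d) (z : Fin d → X × Icc (-R) R) :
    risk ((uniformFin d).map z) h
      = ENNReal.ofReal ((∑ i, |h (z i).1 - ((z i).2 : ℝ)|) / d) := by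
  have := isProbabilityMeasure_uniformFin hd
  have hz : Measurable z := measurable_of_finite z
  have := Measure.isProbabilityMeasure_map (μ := uniformFin d) hz.aemeasurable
  rw [risk, lintegral_map' (aemeasurable_loss hh _).ennreal_ofReal hz.aemeasurable]
  exact lintegral_uniformFin hd _ fun i => abs_nonneg _

/-- Label each shattered point by `R` or `-R` at random. At an unseen point the two possible losses
of any prediction sum to at least `2 * R`, whereas a function realizing the pattern gains `γ' / 2`
on average, the witnesses cancelling between opposite labels. -/
theorem fatDim_lt_top_of_learnable {F : Set (X → ℝ)} {R : ℝ}
    (hR : ∀ f ∈ F, ∀ x, f x ∈ Icc (-R) R) (hF : IsMeasurableClass F) {γ : ℝ} (hγ : 0 < γ)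
    (hlearn : Learnable R (γ / 2) F) {γ' : ℝ} (hγ' : γ < γ') : fatDim γ' F < ⊤ := by
  classical
  by_contra hfat
  set κ := γ' - γ with hκ
  have hκ0 : 0 < κ := sub_pos.2 hγ'
  have hR0 : 0 ≤ R := by
    obtain ⟨d, hd, x, r, hsh⟩ := exists_shatters_ge_of_not_fatDim_lt_top hfat 1
    obtain ⟨f, hf, -⟩ := hsh fun _ => true
    have := hR f hf (x ⟨0, hd⟩)
    linarith [this.1, this.2]
  obtain ⟨A, hA, hlearn⟩ := hlearn
  -- Failures then add at most `2 * R * δ ≤ κ / 8` to the expected loss.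
  set δ := κ / (16 * (R + 1)) with hδ
  have hδ0 : 0 < δ := by positivity
  obtain ⟨n, hn⟩ := hlearn (κ / 8) (by positivity) δ hδ0
  obtain ⟨N, hN⟩ := exists_nat_ge (8 * R * n / κ)
  obtain ⟨d, hd, x, r, hsh⟩ := exists_shatters_ge_of_not_fatDim_lt_top hfat (N + 1)
  have hd0 : 0 < d := by omega
  have hd0' : (0 : ℝ) < d := by exact_mod_cast hd0
  have hdn : R * n ≤ κ / 8 * d := by
    rw [div_le_iff₀ hκ0] at hN
    have : (N : ℝ) ≤ d := by exact_mod_cast (by omega : N ≤ d)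
    nlinarith
  have := isProbabilityMeasure_uniformFin hd0
  set y : Bool → Icc (-R) R := fun b => if b then ⟨R, by linarith, le_rfl⟩
    else ⟨-R, le_rfl, by linarith⟩ with hy
  have hyt : (y true : ℝ) = R := by simp [hy]
  have hyf : (y false : ℝ) = -R := by simp [hy]
  choose f hfF hf using hsh
  set z : (Fin d → Bool) → Fin d → X × Icc (-R) R := fun b i => (x i, y (b i)) with hz
  set out : (Fin d → Bool) → (Fin n → Fin d) → X → ℝ := fun b S => A n fun j => z b (S j) with hout
  -- Hypotheses may be unbounded; clipping does not increase the loss and bounds it by `2 * R` on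
  -- the failure event.
  set clip : ℝ → ℝ := fun v => max (-R) (min R v) with hclip
  set loss : (Fin d → Bool) → (Fin n → Fin d) → ℝ :=
    fun b S => (∑ i, |clip (out b S (x i)) - (y (b i) : ℝ)|) / d with hloss
  set best : (Fin d → Bool) → ℝ := fun b => (∑ i, |f b (x i) - (y (b i) : ℝ)|) / d with hbest
  have hclip_le : ∀ v b, |clip v - (y b : ℝ)| ≤ |v - (y b : ℝ)| := by
    intro v b
    rw [hclip]
    cases b
    · rw [hyf]
      rcases le_total R v with h | h <;> rcases le_total (-R) v with h' | h' <;>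
        simp only [min_eq_left, min_eq_right, max_eq_left, max_eq_right, h, h',
          neg_le_self hR0] <;> rw [abs_le] <;>
        constructor <;> cases abs_cases (v - -R) <;> linarith
    · rw [hyt]
      rcases le_total R v with h | h <;> rcases le_total (-R) v with h' | h' <;>
        simp only [min_eq_left, min_eq_right, max_eq_left, max_eq_right, h, h',
          neg_le_self hR0] <;> rw [abs_le] <;>
        constructor <;> cases abs_cases (v - R) <;> linarith
  have hclip_mem : ∀ v b, |clip v - (y b : ℝ)| ≤ 2 * R := by
    intro v b
    have h1 : -R ≤ clip v := le_max_left _ _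
    have h2 : clip v ≤ R := max_le (by linarith) (min_le_left _ _)
    rw [abs_le]
    constructor <;> linarith [(y b).2.1, (y b).2.2]
  have hloss_le : ∀ b S, loss b S ≤ 2 * R := by
    intro b S
    rw [hloss]
    simp only
    rw [div_le_iff₀ hd0']
    refine (Finset.sum_le_sum fun i _ => hclip_mem _ _).trans_eq ?_
    simp [mul_comm]
  -- an upper bound for the expected loss of the learner on each of the distributions
  have hupper : ∀ b, ∫ S, loss b S ∂(Measure.pi fun _ : Fin n => uniformFin d)
      ≤ best b + γ / 2 + κ / 8 + 2 * R * δ := by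
    intro b
    set q := (uniformFin d).map (z b)
    have hq : IsProbabilityMeasure q :=
      Measure.isProbabilityMeasure_map (measurable_of_finite _).aemeasurable
    have hfail := (pi_uniformFin_preimage_le hd0 (z b) n _).trans (hn q hq n le_rfl)
    set G : Set (Fin n → Fin d) := {S | (fun j => z b (S j)) ∈ {S : Fin n → X × Icc (-R) R |
      ¬ risk q (A n S) ≤ (⨅ f ∈ F, risk q f) + ENNReal.ofReal (γ / 2 + κ / 8)}} with hG
    have hpt : ∀ S, loss b S ≤ (best b + γ / 2 + κ / 8) + G.indicator (fun _ => 2 * R) S := by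
      intro S
      have hbest0 : 0 ≤ best b :=
        div_nonneg (Finset.sum_nonneg fun i _ => abs_nonneg _) hd0'.le
      by_cases hS : S ∈ G
      · rw [Set.indicator_of_mem hS]
        linarith [hloss_le b S]
      · rw [Set.indicator_of_notMem hS, add_zero]
        simp only [hG, mem_ofPred_eq, not_not] at hS
        have h1 := hS.trans (add_le_add_left (iInf₂_le (f b) (hfF b)) _)
        rw [risk_map_uniformFin (hA n _) hd0,
          risk_map_uniformFin (hF.measurable_mem _ (hfF b)) hd0,
          ← ENNReal.ofReal_add hbest0 (by positivity),
          ENNReal.ofReal_le_ofReal_iff (by positivity)] at h1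
        refine le_trans ?_ (h1.trans_eq (by ring))
        exact div_le_div_of_nonneg_right (Finset.sum_le_sum fun i _ => hclip_le _ _) hd0'.le
    refine (integral_mono Integrable.of_finite Integrable.of_finite hpt).trans ?_
    rw [integral_add Integrable.of_finite Integrable.of_finite, integral_const,
      integral_indicator_const _ (Set.toFinite G).measurableSet]
    simp only [probReal_univ, smul_eq_mul]
    have : (Measure.pi fun _ : Fin n => uniformFin d).real G ≤ δ :=
      ENNReal.toReal_le_of_le_ofReal hδ0.le hfail
    nlinarith
  -- the functions realizing the patterns have small losses on average
  have hbest_sum : ∑ b, best b ≤ 2 ^ d * (R - γ' / 2) := by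
    have hpt : ∀ b i, |f b (x i) - (y (b i) : ℝ)| ≤ R - γ' / 2 - boolSign (b i) * r i := by
      intro b i
      have hfb := hR _ (hfF b) (x i)
      cases hb : b i
      · have := (hf b i).2 hb
        rw [hyf, abs_of_nonneg (by linarith [hfb.1])]
        simp only [boolSign, Bool.false_eq_true, if_false]
        linarith
      · have := (hf b i).1 hb
        rw [hyt, abs_of_nonpos (by linarith [hfb.2])]
        simp only [boolSign, if_true]
        linarith
    have h1 : ∀ i, ∑ b, |f b (x i) - (y (b i) : ℝ)| ≤ 2 ^ d * (R - γ' / 2) := by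
      intro i
      have h2 := two_pow_mul_le_sum_of_flip i (fun b => -(R - γ' / 2 - boolSign (b i) * r i))
        (-(R - γ' / 2)) (fun b => by
          simp only [Function.update_self]
          cases b i <;> simp [boolSign] <;> linarith)
      rw [Finset.sum_neg_distrib] at h2
      refine (Finset.sum_le_sum fun b _ => hpt b i).trans ?_
      linarith
    rw [hbest, ← Finset.sum_div, Finset.sum_comm, div_le_iff₀ hd0']
    refine (Finset.sum_le_sum fun i _ => h1 i).trans_eq ?_
    simp [mul_comm]
  -- the learner has large losses on average
  have hlower : ∀ S, 2 ^ d * (R * (d - n)) / d ≤ ∑ b, loss b S := by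
    intro S
    rw [hloss, ← Finset.sum_div, Finset.sum_comm]
    refine div_le_div_of_nonneg_right ?_ hd0'.le
    have hpt : ∀ i, (2 : ℝ) ^ d * (R - if i ∈ Finset.univ.image S then R else 0)
        ≤ ∑ b, |clip (out b S (x i)) - (y (b i) : ℝ)| := by
      intro i
      split_ifs with hi
      · rw [sub_self, mul_zero]
        exact Finset.sum_nonneg fun b _ => abs_nonneg _
      · rw [sub_zero]
        refine two_pow_mul_le_sum_of_flip i _ _ fun b => ?_
        -- The label of an unsampled point is invisible to the learner.
        have hsame : out (Function.update b i (!b i)) S = out b S := by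
          simp only [hout]
          congr 1
          funext j
          have : S j ≠ i := fun h => hi (Finset.mem_image.2 ⟨j, Finset.mem_univ _, h⟩)
          simp [hz, Function.update_of_ne this]
        rw [hsame, Function.update_self]
        set v := clip (out b S (x i))
        have h2 := neg_abs_le (v - R)
        have h3 := le_abs_self (v - -R)
        cases b i <;> simp only [Bool.not_false, Bool.not_true, hyt, hyf] <;> linarith
    refine le_trans ?_ (Finset.sum_le_sum fun i _ => hpt i)
    rw [← Finset.mul_sum, Finset.sum_sub_distrib, Finset.sum_ite_mem, Finset.univ_inter,
      Finset.sum_const, Finset.sum_const, Finset.card_univ, Fintype.card_fin, nsmul_eq_mul,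
      nsmul_eq_mul]
    have hc : ((Finset.univ.image S).card : ℝ) ≤ n := by
      exact_mod_cast Finset.card_image_le.trans_eq (by simp)
    refine mul_le_mul_of_nonneg_left ?_ (by positivity)
    nlinarith
  have h1 : 2 ^ d * (R * (d - n)) / d
      ≤ ∑ b, ∫ S, loss b S ∂(Measure.pi fun _ : Fin n => uniformFin d) := by
    rw [← integral_finsetSum _ fun b _ => Integrable.of_finite]
    have h := integral_mono (μ := Measure.pi fun _ : Fin n => uniformFin d)
      (integrable_const _) Integrable.of_finite hlower
    rwa [integral_const, probReal_univ, one_smul] at h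
  have h2 := h1.trans (Finset.sum_le_sum fun b _ => hupper b)
  have h3 : ∑ b, (best b + γ / 2 + κ / 8 + 2 * R * δ)
      = ∑ b, best b + 2 ^ d * (γ / 2 + κ / 8 + 2 * R * δ) := by
    simp only [Finset.sum_add_distrib, Finset.sum_const, Finset.card_univ, nsmul_eq_mul,
      Fintype.card_pi, Fintype.card_bool, Finset.prod_const, Fintype.card_fin, Nat.cast_pow,
      Nat.cast_ofNat]
    ring
  rw [h3] at h2
  have h4 : (2 : ℝ) ^ d * (R * (d - n) / d)
      ≤ 2 ^ d * (R - γ' / 2 + (γ / 2 + κ / 8 + 2 * R * δ)) := by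
    rw [mul_add, ← mul_div_assoc]
    linarith
  have h5 := le_of_mul_le_mul_left h4 (by positivity)
  rw [div_le_iff₀ hd0'] at h5
  have h6 : 2 * R * δ ≤ κ / 8 := by
    rw [hδ, mul_div_assoc', div_le_iff₀ (by positivity)]
    nlinarith
  -- The bounds combine to `κ / 2 ≤ 3 * κ / 8`, which is absurd.
  nlinarith

end LowerBounds

/-! ### A transductive learner with small expected risk -/

section Learner

/-- On a fixed double sample, the average test error over the random choices of the half used for
training. -/
lemma sum_test_error_le {X : Type*} {F : Set (X → ℝ)} {R η g : ℝ}
    (hR : ∀ f ∈ F, ∀ x, f x ∈ Icc (-R) R) (hη : 0 < η) (hg : 0 ≤ g) {L d t : ℕ}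
    (hL : 2 * R ≤ L * η) (hL0 : 0 < L) (hd : ∀ d', Shatters (2 * g) F d' → d' ≤ d)
    {θ : ℝ} (hθ : 0 < θ) (w : Fin t × Bool → X × Icc (-R) R)
    (ch : (Fin t → Bool) → Fin t × Bool → ℝ)
    (hch : ∀ σ, ch σ ∈ centers R η (d * (Nat.log 2 (t * (2 * L) + 1) + 1))
        (Realizes (L := L) F R η g fun i => (w i).1) ∧
      ∀ c ∈ centers R η (d * (Nat.log 2 (t * (2 * L) + 1) + 1))
        (Realizes (L := L) F R η g fun i => (w i).1),
        ∑ i, |ch σ (i, σ i) - ((w (i, σ i)).2 : ℝ)| ≤ ∑ i, |c (i, σ i) - ((w (i, σ i)).2 : ℝ)|)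
    {f : X → ℝ} (hf : f ∈ F) :
    ∑ σ, ∑ i, |ch σ (i, !σ i) - ((w (i, !σ i)).2 : ℝ)|
      ≤ ∑ σ : Fin t → Bool, ∑ i, |f (w (i, σ i)).1 - ((w (i, σ i)).2 : ℝ)|
        + 2 ^ t * t * (g + η + θ + L * η * (((t * (2 * L) * 2 + 1 : ℕ) : ℝ)
          ^ (d * (Nat.log 2 (t * (2 * L) + 1) + 1))
          * Real.exp (-(θ ^ 2 / (2 * (L * η) ^ 2)) * t))) := by
  classical
  set N : ℝ := ((t * (2 * L) * 2 + 1 : ℕ) : ℝ) ^ (d * (Nat.log 2 (t * (2 * L) + 1) + 1)) with hN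
  set e : ℝ := Real.exp (-(θ ^ 2 / (2 * (L * η) ^ 2)) * t) with he
  set C := centers R η (d * (Nat.log 2 (t * (2 * L) + 1) + 1))
    (Realizes (L := L) F R η g fun i => (w i).1) with hC
  have hB : (0 : ℝ) < L * η := mul_pos (by exact_mod_cast hL0) hη
  have hcard : Fintype.card (Fin t × Bool) * L = t * (2 * L) := by simp [mul_assoc]
  have hcardC : (C.card : ℝ) ≤ N := by
    have h := card_centers_le R η (d * (Nat.log 2 (t * (2 * L) + 1) + 1))
      (Realizes (L := L) F R η g fun i => (w i).1)
    rw [hcard] at h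
    rw [hN, hC]
    exact_mod_cast h
  have hloss : ∀ c ∈ C, ∀ p, |c p - ((w p).2 : ℝ)| ≤ L * η := by
    intro c hc p
    have h1 := mem_Icc_of_mem_centers hη hc p
    have h2 := (w p).2.2
    rw [abs_le]
    constructor <;> linarith [h1.1, h1.2, h2.1, h2.2]
  set v : (Fin t × Bool → ℝ) → Fin t → ℝ := fun c i =>
    |c (i, false) - ((w (i, false)).2 : ℝ)| - |c (i, true) - ((w (i, true)).2 : ℝ)| with hv
  have hvB : ∀ c ∈ C, ∀ i, |v c i| ≤ L * η := by
    intro c hc i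
    have h1 := hloss c hc (i, false)
    have h2 := hloss c hc (i, true)
    have h3 := abs_nonneg (c (i, false) - ((w (i, false)).2 : ℝ))
    have h4 := abs_nonneg (c (i, true) - ((w (i, true)).2 : ℝ))
    rw [abs_le]
    constructor <;> linarith
  have hbad := card_exists_boolSign_sum_gt_le C v hB hvB hθ
  -- Test error minus training error is a signed sum, whatever the labels.
  have hdiff : ∀ (σ : Fin t → Bool) (c : Fin t × Bool → ℝ),
      ∑ i, |c (i, !σ i) - ((w (i, !σ i)).2 : ℝ)|
        = ∑ i, |c (i, σ i) - ((w (i, σ i)).2 : ℝ)| + ∑ i, boolSign (σ i) * v c i := by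
    intro σ c
    rw [← Finset.sum_add_distrib]
    refine Finset.sum_congr rfl fun i _ => ?_
    cases σ i <;> simp [boolSign, hv]
  -- The cover radius enters once, when the chosen center competes with the one near `f` on the
  -- training half. For bad signs the gap between test and training error is bounded trivially by `t
  -- * (L * η)`.
  have hσ : ∀ σ : Fin t → Bool, ∑ i, |ch σ (i, !σ i) - ((w (i, !σ i)).2 : ℝ)|
      ≤ ∑ i, |f (w (i, σ i)).1 - ((w (i, σ i)).2 : ℝ)| + t * (g + η + θ)
        + if ∃ c ∈ C, t * θ < ∑ i, boolSign (σ i) * v c i then t * (L * η) else 0 := by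
    intro σ
    obtain ⟨hmem, hmin⟩ := hch σ
    obtain ⟨c, hc, hfc⟩ := exists_center hη hg hL hd (fun i => (w i).1) hf (hR f hf)
    rw [hcard] at hc
    have h1 : ∑ i, |c (i, σ i) - ((w (i, σ i)).2 : ℝ)|
        ≤ ∑ i, |f (w (i, σ i)).1 - ((w (i, σ i)).2 : ℝ)| + t * (g + η) := by
      have : (t : ℝ) * (g + η) = ∑ _i : Fin t, (g + η) := by simp; ring
      rw [this, ← Finset.sum_add_distrib]
      refine Finset.sum_le_sum fun i _ => ?_
      have h2 := hfc (i, σ i)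
      have h3 := abs_sub_le (c (i, σ i)) (f (w (i, σ i)).1) ((w (i, σ i)).2 : ℝ)
      rw [abs_sub_comm (c (i, σ i)) (f (w (i, σ i)).1)] at h3
      linarith
    have h2 := hmin c hc
    rw [hdiff σ (ch σ)]
    split_ifs with hb
    · have h3 : ∑ i, boolSign (σ i) * v (ch σ) i ≤ t * (L * η) := by
        refine (Finset.sum_le_sum (g := fun _ => L * η) fun i _ => ?_).trans_eq (by simp)
        have h4 := abs_le.1 (hvB _ hmem i)
        cases σ i <;> simp [boolSign] <;> linarith
      have h5 : (0 : ℝ) ≤ t * θ := by positivity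
      linarith
    · push Not at hb
      have h3 := hb _ hmem
      linarith
  refine (Finset.sum_le_sum fun σ _ => hσ σ).trans ?_
  rw [Finset.sum_add_distrib, Finset.sum_add_distrib, ← Finset.sum_filter, Finset.sum_const,
    Finset.sum_const, nsmul_eq_mul, nsmul_eq_mul]
  have hc2 : ((Finset.univ : Finset (Fin t → Bool)).card : ℝ) = 2 ^ t := by simp
  have h6 : (C.card : ℝ) * (2 ^ t * e) ≤ N * (2 ^ t * e) :=
    mul_le_mul_of_nonneg_right hcardC (by positivity)
  have h7 := mul_le_mul_of_nonneg_right (hbad.trans h6) (show 0 ≤ t * (L * η) by positivity)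
  rw [hc2]
  linarith

variable {X : Type*} [MeasurableSpace X]

/-- The last clause is what makes the choice a legitimate learner: it uses all points but only the
labels of the training half. -/
lemma exists_empirical_risk_minimizer {F : Set (X → ℝ)} (hF : IsMeasurableClass F)
    (R η g : ℝ) (L K t : ℕ) :
    ∃ Ch : (Fin t → Bool) → (Fin t × Bool → X × Icc (-R) R) → Fin t × Bool → ℝ,
      (∀ σ p, UniversallyMeasurable fun w => Ch σ w p) ∧
      (∀ σ w, Ch σ w ∈ centers R η K (Realizes (L := L) F R η g fun i => (w i).1) ∧
        ∀ c ∈ centers R η K (Realizes (L := L) F R η g fun i => (w i).1),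
          ∑ i, |Ch σ w (i, σ i) - ((w (i, σ i)).2 : ℝ)| ≤ ∑ i, |c (i, σ i) - ((w (i, σ i)).2 : ℝ)|)
      ∧ ∀ σ w w', (∀ i, (w i).1 = (w' i).1) → (∀ i, w (i, σ i) = w' (i, σ i)) →
          Ch σ w = Ch σ w' := by
  classical
  have hsel := fun (σ : Fin t → Bool)
      (ρ : Finset (((Fin t × Bool) × Fin L) × Bool) → Prop) =>
    exists_measurable_argmin (E := Fin t × Bool → ℝ) (Λ := Fin t → ℝ)
      (fun c l => ∑ i, |c (i, σ i) - l i|) (by fun_prop) (centers_nonempty R η K ρ)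
  choose sel hselm hsel using hsel
  refine ⟨fun σ w => sel σ (Realizes F R η g fun i => (w i).1) fun i => (w (i, σ i)).2,
    fun σ p μ hμ => ?_, fun σ w => hsel σ _ _, fun σ w w' h1 h2 => ?_⟩
  · have hfst : Measurable fun (w : Fin t × Bool → X × Icc (-R) R) (i : Fin t × Bool) =>
        (w i).1 := by fun_prop
    have hρ : AEMeasurable (fun (w : Fin t × Bool → X × Icc (-R) R) =>
        (Realizes F R η g fun i => (w i).1 :
          Finset (((Fin t × Bool) × Fin L) × Bool) → Prop)) μ := by
      refine aemeasurable_pi_lambda _ fun C => aemeasurable_prop_of_nullMeasurableSet ?_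
      have := Measure.isProbabilityMeasure_map (μ := μ) hfst.aemeasurable
      exact (hF.nullMeasurableSet_realizes R η g C (μ.map _)).preimage
        (hfst.measurePreserving μ).quasiMeasurePreserving
    have hl : Measurable fun (w : Fin t × Bool → X × Icc (-R) R) (i : Fin t) =>
        ((w (i, σ i)).2 : ℝ) :=
      measurable_pi_lambda _ fun i =>
        measurable_subtype_coe.comp (measurable_snd.comp (measurable_pi_apply _))
    have hG : Measurable fun u : (Finset (((Fin t × Bool) × Fin L) × Bool) → Prop) × (Fin t → ℝ) =>
        sel σ u.1 u.2 p :=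
      -- The realizability pattern takes finitely many values, so measurability in the labels for
      -- each pattern suffices.
      measurable_from_prod_countable_right fun ρ => (measurable_pi_apply p).comp (hselm σ ρ)
    exact hG.comp_aemeasurable (hρ.prodMk hl.aemeasurable)
  · have e1 : (fun i => (w i).1) = fun i => (w' i).1 := funext h1
    simp only [e1, h2]

/-- Convexity of the absolute loss. -/
lemma card_mul_risk_average_le {R : ℝ} (q : Measure (X × Icc (-R) R)) [IsProbabilityMeasure q]
    {κ : Type*} [Fintype κ] [Nonempty κ] {h : κ → X → ℝ} (hh : ∀ a, UniversallyMeasurable (h a)) :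
    (Fintype.card κ : ℝ≥0∞) * risk q (fun x => (∑ a, h a x) / Fintype.card κ)
      ≤ ∑ a, risk q (h a) := by
  have hc : (0 : ℝ) < Fintype.card κ := by exact_mod_cast Fintype.card_pos
  unfold risk
  rw [← lintegral_finsetSum' _ fun a _ => (aemeasurable_loss (hh a) q).ennreal_ofReal,
    ← lintegral_const_mul' _ _ (by simp)]
  refine lintegral_mono fun p => ?_
  simp only
  rw [← ENNReal.ofReal_natCast, ← ENNReal.ofReal_mul (by positivity),
    ← ENNReal.ofReal_sum_of_nonneg fun _ _ => abs_nonneg _]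
  refine ENNReal.ofReal_le_ofReal ?_
  calc (Fintype.card κ : ℝ) * |(∑ a, h a p.1) / Fintype.card κ - (p.2 : ℝ)|
      = |∑ a, (h a p.1 - (p.2 : ℝ))| := by
        nth_rewrite 1 [← abs_of_pos hc]
        rw [← abs_mul, Finset.sum_sub_distrib, Finset.sum_const, Finset.card_univ, nsmul_eq_mul,
          mul_sub, mul_div_cancel₀ _ hc.ne']
    _ ≤ _ := Finset.abs_sum_le_sum_abs _ _

lemma UniversallyMeasurable.average {κ : Type*} [Fintype κ] {h : κ → X → ℝ}
    (hh : ∀ a, UniversallyMeasurable (h a)) :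
    UniversallyMeasurable fun x => (∑ a, h a x) / Fintype.card κ := fun q hq =>
  (Finset.aemeasurable_fun_sum _ fun a _ => hh a q hq).div_const _

lemma aemeasurable_lossOn {R : ℝ} {Ω : Type*} [MeasurableSpace Ω] {H : Ω → X → ℝ}
    (hH : UniversallyMeasurable fun p : Ω × X => H p.1 p.2) (μ : Measure Ω)
    [IsProbabilityMeasure μ] (q : Measure (X × Icc (-R) R)) [IsProbabilityMeasure q] :
    AEMeasurable (fun p : Ω × (X × Icc (-R) R) => ENNReal.ofReal |H p.1 p.2.1 - (p.2.2 : ℝ)|)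
      (μ.prod q) := by
  have h1 := hH.comp (φ := fun p : Ω × (X × Icc (-R) R) => (p.1, p.2.1)) (by fun_prop)
    (μ.prod q) inferInstance
  exact ((h1.sub (measurable_subtype_coe.comp
    (measurable_snd.comp measurable_snd)).aemeasurable).abs).ennreal_ofReal

/-- A learner with small expected risk. -/
lemma exists_learner_expected_risk_le {F : Set (X → ℝ)} {R η g : ℝ}
    (hR : ∀ f ∈ F, ∀ x, f x ∈ Icc (-R) R) (hF : IsMeasurableClass F)
    (hη : 0 < η) (hg : 0 ≤ g) {L d t : ℕ}
    (hL : 2 * R ≤ L * η) (hL0 : 0 < L) (ht : 0 < t)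
    (hd : ∀ d', Shatters (2 * g) F d' → d' ≤ d) {θ : ℝ} (hθ : 0 < θ) :
    ∃ H : (Fin t × Bool → X × Icc (-R) R) → X → ℝ,
      (UniversallyMeasurable fun p : (Fin t × Bool → X × Icc (-R) R) × X => H p.1 p.2) ∧
      (∀ S x, |H S x| ≤ |R| + L * η) ∧
      ∀ q : Measure (X × Icc (-R) R), IsProbabilityMeasure q → ∀ f ∈ F,
        ∫⁻ S, risk q (H S) ∂(Measure.pi fun _ => q) ≤ risk q f +
          ENNReal.ofReal (g + η + θ + L * η * (((t * (2 * L) * 2 + 1 : ℕ) : ℝ)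
            ^ (d * (Nat.log 2 (t * (2 * L) + 1) + 1))
            * Real.exp (-(θ ^ 2 / (2 * (L * η) ^ 2)) * t))) := by
  classical
  set E : ℝ := g + η + θ + L * η * (((t * (2 * L) * 2 + 1 : ℕ) : ℝ)
            ^ (d * (Nat.log 2 (t * (2 * L) + 1) + 1))
            * Real.exp (-(θ ^ 2 / (2 * (L * η) ^ 2)) * t)) with hE
  have hE0 : 0 ≤ E := by positivity
  obtain ⟨Ch, hChm, hCh, hChc⟩ := exists_empirical_risk_minimizer hF R η g L
    (d * (Nat.log 2 (t * (2 * L) + 1) + 1)) t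
  have : Nonempty (Fin t) := ⟨⟨0, ht⟩⟩
  let κ := (Fin t → Bool) × Fin t
  have hκcard : Fintype.card κ = 2 ^ t * t := by simp [κ]
  let pt : κ → Fin t × Bool := fun a => (a.2, !a.1 a.2)
  let ins : κ → (Fin t × Bool → X × Icc (-R) R) × X → (Fin t × Bool → X × Icc (-R) R) :=
    fun a p => Function.update p.1 (pt a) (p.2, (p.1 (pt a)).2)
  have hins : ∀ a, Measurable (ins a) := by
    intro a
    refine measurable_pi_lambda _ fun j => ?_
    by_cases h : j = pt a
    · subst h
      simp only [ins, Function.update_self]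
      fun_prop
    · simp only [ins, Function.update_of_ne h]
      fun_prop
  let h : κ → (Fin t × Bool → X × Icc (-R) R) → X → ℝ := fun a S x =>
    Ch a.1 (ins a (S, x)) (pt a)
  have hh : ∀ a, UniversallyMeasurable
      fun p : (Fin t × Bool → X × Icc (-R) R) × X => h a p.1 p.2 :=
    fun a => (hChm a.1 (pt a)).comp (hins a)
  have hhS : ∀ a S, UniversallyMeasurable (h a S) := fun a S =>
    (hh a).comp (φ := fun x => (S, x)) (by fun_prop)
  refine ⟨fun S x => (∑ a, h a S x) / Fintype.card κ, UniversallyMeasurable.average hh,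
    fun S x => ?_, fun q hq f hf => ?_⟩
  · have hc : (0 : ℝ) < Fintype.card κ := by exact_mod_cast Fintype.card_pos
    rw [abs_div, abs_of_pos hc, div_le_iff₀ hc]
    refine (Finset.abs_sum_le_sum_abs _ _).trans ((Finset.sum_le_sum
      (g := fun _ => |R| + L * η) fun a _ => ?_).trans_eq
        (by rw [Finset.sum_const, nsmul_eq_mul, Finset.card_univ, mul_comm]))
    have h1 := mem_Icc_of_mem_centers hη (hCh a.1 (ins a (S, x))).1 (pt a)
    have h2 : 0 ≤ L * η := by positivity
    rw [abs_le]
    constructor <;> cases abs_cases R <;> linarith [h1.1, h1.2]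
  · set π := Measure.pi fun _ : Fin t × Bool => q with hπ
    -- each summand of the learner is tested on a fresh point
    have hfresh : ∀ a, ∫⁻ S, risk q (h a S) ∂π
        = ∫⁻ w, ENNReal.ofReal |Ch a.1 w (pt a) - ((w (pt a)).2 : ℝ)| ∂π := by
      intro a
      unfold risk
      rw [lintegral_lintegral (aemeasurable_lossOn (hh a) π q)]
      have hup := measurePreserving_update q (pt a)
      rw [← hπ] at hup
      have hm : AEMeasurable (fun w : Fin t × Bool → X × Icc (-R) R =>
          ENNReal.ofReal |Ch a.1 w (pt a) - ((w (pt a)).2 : ℝ)|) π :=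
        (((hChm a.1 (pt a)) π inferInstance).sub (measurable_subtype_coe.comp
          (measurable_snd.comp (measurable_pi_apply _))).aemeasurable).abs.ennreal_ofReal
      have hm' := hm
      rw [← hup.map_eq] at hm'
      conv_rhs => rw [← hup.map_eq]
      rw [lintegral_map' hm' hup.measurable.aemeasurable]
      refine lintegral_congr fun p => ?_
      -- The two samples differ only in a test label, which the choice of center ignores.
      have hsame : Ch a.1 (ins a (p.1, p.2.1)) = Ch a.1 (Function.update p.1 (pt a) p.2) := by
        refine hChc _ _ _ (fun i => ?_) (fun i => ?_)
        · by_cases hi : i = pt a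
          · subst hi; simp [ins]
          · simp [ins, Function.update_of_ne hi]
        · have hi : (i, a.1 i) ≠ pt a := by
            intro hcon
            simp only [pt, Prod.mk.injEq] at hcon
            obtain ⟨rfl, hcon⟩ := hcon
            simp at hcon
          simp [ins, Function.update_of_ne hi]
      simp only [h, hsame, Function.update_self]
    have htrain : ∀ (σ : Fin t → Bool) (i : Fin t),
        ∫⁻ w, ENNReal.ofReal |f (w (i, σ i)).1 - ((w (i, σ i)).2 : ℝ)| ∂π = risk q f := by
      intro σ i
      have hev := measurePreserving_eval (fun _ : Fin t × Bool => q) (i, σ i)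
      have hm := (aemeasurable_loss (hF.measurable_mem f hf) q).ennreal_ofReal
      unfold risk
      rw [← hev.map_eq] at hm
      conv_rhs => rw [← hev.map_eq]
      rw [lintegral_map' hm hev.measurable.aemeasurable]
    have htrainm : ∀ (σ : Fin t → Bool) (i : Fin t), AEMeasurable
        (fun w : Fin t × Bool → X × Icc (-R) R =>
          ENNReal.ofReal |f (w (i, σ i)).1 - ((w (i, σ i)).2 : ℝ)|) π := by
      intro σ i
      have hev := measurePreserving_eval (fun _ : Fin t × Bool => q) (i, σ i)
      exact (aemeasurable_loss (hF.measurable_mem f hf) q).ennreal_ofReal.comp_quasiMeasurePreserving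
        hev.quasiMeasurePreserving
    have hmain : (Fintype.card κ : ℝ≥0∞)
          * ∫⁻ S, risk q (fun x => (∑ a, h a S x) / Fintype.card κ) ∂π
        ≤ Fintype.card κ * (risk q f + ENNReal.ofReal E) := by
      calc _ = ∫⁻ S, Fintype.card κ * risk q (fun x => (∑ a, h a S x) / Fintype.card κ) ∂π :=
            (lintegral_const_mul' _ _ (by simp)).symm
        _ ≤ ∫⁻ S, ∑ a, risk q (h a S) ∂π :=
            lintegral_mono fun S => card_mul_risk_average_le q fun a => hhS a S
        _ = ∑ a, ∫⁻ S, risk q (h a S) ∂π :=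
            lintegral_finsetSum' _ fun a _ => (aemeasurable_lossOn (hh a) π q).lintegral_prod_right'
        _ = ∑ a : κ, ∫⁻ w, ENNReal.ofReal |Ch a.1 w (pt a) - ((w (pt a)).2 : ℝ)| ∂π :=
            Finset.sum_congr rfl fun a _ => hfresh a
        _ = ∫⁻ w, ∑ a : κ, ENNReal.ofReal |Ch a.1 w (pt a) - ((w (pt a)).2 : ℝ)| ∂π :=
            (lintegral_finsetSum' _ fun a _ =>
              (((hChm a.1 (pt a)) π inferInstance).sub (measurable_subtype_coe.comp
                (measurable_snd.comp (measurable_pi_apply _))).aemeasurable).abs.ennreal_ofReal).symm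
        _ ≤ ∫⁻ w, (∑ σ : Fin t → Bool, ∑ i, ENNReal.ofReal
              |f (w (i, σ i)).1 - ((w (i, σ i)).2 : ℝ)|) + ENNReal.ofReal (2 ^ t * t * E) ∂π := by
            refine lintegral_mono fun w => ?_
            have hw := sum_test_error_le hR hη hg hL hL0 hd hθ w (fun σ => Ch σ w)
              (fun σ => hCh σ w) hf
            rw [← hE] at hw
            simp only
            rw [← ENNReal.ofReal_sum_of_nonneg fun _ _ => abs_nonneg _, Fintype.sum_prod_type]
            simp_rw [← ENNReal.ofReal_sum_of_nonneg fun i (_ : i ∈ Finset.univ) =>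
              abs_nonneg (f (w (i, _)).1 - ((w (i, _)).2 : ℝ))]
            rw [← ENNReal.ofReal_sum_of_nonneg fun _ _ => Finset.sum_nonneg fun _ _ => abs_nonneg _,
              ← ENNReal.ofReal_add (Finset.sum_nonneg fun _ _ => Finset.sum_nonneg
                fun _ _ => abs_nonneg _) (by positivity)]
            exact ENNReal.ofReal_le_ofReal hw
        _ = Fintype.card κ * (risk q f + ENNReal.ofReal E) := by
            rw [lintegral_add_right _ measurable_const, lintegral_const, measure_univ, mul_one,
              lintegral_finsetSum' _ fun σ _ => Finset.aemeasurable_fun_sum _ fun i _ => htrainm σ i]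
            simp_rw [lintegral_finsetSum' _ fun i (_ : i ∈ Finset.univ) => htrainm _ i, htrain]
            rw [hκcard, ENNReal.ofReal_mul (by positivity), ENNReal.ofReal_mul (by positivity)]
            simp [mul_add, mul_assoc]
    exact (ENNReal.mul_le_mul_iff_right (by simp [Fintype.card_ne_zero]) (by simp)).1 hmain

end Learner

/-! ### From expected risk to agnostic learnability -/

section Learnability

variable {X : Type*} [MeasurableSpace X]

/-- Averaging over independent blocks turns a bound on the expected risk into one that holds with
high probability. -/
lemma measure_block_average_risk_gt_le {F : Set (X → ℝ)} {R : ℝ} {ι : Type*} [Fintype ι]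
    {H : (ι → X × Icc (-R) R) → X → ℝ}
    (hH : UniversallyMeasurable fun p : (ι → X × Icc (-R) R) × X => H p.1 p.2) {B : ℝ}
    (hHB : ∀ S x, |H S x| ≤ B) (q : Measure (X × Icc (-R) R)) [IsProbabilityMeasure q] {a ε δ : ℝ}
    (ha : 0 ≤ a) (hε : 0 < ε)
    (hrisk : ∀ f ∈ F, ∫⁻ S, risk q (H S) ∂(Measure.pi fun _ => q) ≤ risk q f + ENNReal.ofReal a)
    {k : ℕ} (hk : 0 < k) (hkB : (B + R) ^ 2 ≤ k * ε ^ 2 * δ) :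
    Measure.pi (fun _ : Fin k => Measure.pi fun _ : ι => q)
      {T | ¬ risk q (fun x => (∑ b, H (T b) x) / k)
        ≤ (⨅ f ∈ F, risk q f) + ENNReal.ofReal (a + ε)} ≤ ENNReal.ofReal δ := by
  have hk' : (0 : ℝ) < k := by exact_mod_cast hk
  have : Nonempty (Fin k) := ⟨⟨0, hk⟩⟩
  set π := Measure.pi fun _ : ι => q with hπ
  have hHS : ∀ S, UniversallyMeasurable (H S) := fun S =>
    hH.comp (φ := fun x => (S, x)) (by fun_prop)
  have hBR : 0 ≤ B + R := by
    obtain ⟨p⟩ : Nonempty (X × Icc (-R) R) := nonempty_of_isProbabilityMeasure q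
    have := (abs_nonneg _).trans (hHB (fun _ => p) p.1)
    linarith [p.2.2.1, p.2.2.2]
  have hle : ∀ S, risk q (H S) ≤ ENNReal.ofReal (B + R) := by
    intro S
    refine (lintegral_mono fun p => ENNReal.ofReal_le_ofReal (?_ : _ ≤ B + R)).trans_eq (by simp)
    have h1 := abs_le.1 (hHB S p.1)
    rw [abs_le]
    constructor <;> linarith [h1.1, h1.2, p.2.2.1, p.2.2.2]
  have hfin : ∀ S, risk q (H S) ≠ ⊤ := fun S => ((hle S).trans_lt ENNReal.ofReal_lt_top).ne
  -- The risks of the block hypotheses are independent and bounded, so their mean concentrates, and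
  -- by convexity it dominates the risk of the averaged hypothesis.
  set W : (ι → X × Icc (-R) R) → ℝ := fun S => (risk q (H S)).toReal
  have hriskm : AEMeasurable (fun S => risk q (H S)) π :=
    (aemeasurable_lossOn hH π q).lintegral_prod_right'
  have hWm : AEMeasurable W π := hriskm.ennreal_toReal
  have hWB : ∀ S, |W S| ≤ B + R := fun S => by
    rw [abs_of_nonneg ENNReal.toReal_nonneg]
    exact ENNReal.toReal_le_of_le_ofReal hBR (hle S)
  have hWint : ENNReal.ofReal (∫ S, W S ∂π) = ∫⁻ S, risk q (H S) ∂π := by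
    rw [integral_toReal hriskm (Filter.Eventually.of_forall fun S => (hfin S).lt_top),
      ENNReal.ofReal_toReal]
    refine ((lintegral_mono fun S => hle S).trans_lt ?_).ne
    simp
  refine (measure_mono fun T hT => ?_).trans
    (measure_abs_mean_sub_integral_ge_le π hWm hWB hε hk hkB)
  by_contra hlt
  simp only [mem_ofPred_eq, not_le] at hlt
  refine hT ?_
  have hmean : (∑ b, W (T b)) / k ≤ ∫ S, W S ∂π + ε := by linarith [(abs_lt.1 hlt).2]
  have havg : risk q (fun x => (∑ b, H (T b) x) / k) ≤ ENNReal.ofReal ((∑ b, W (T b)) / k) := by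
    have h := card_mul_risk_average_le q fun b => hHS (T b)
    rw [Fintype.card_fin, mul_comm] at h
    rw [ENNReal.ofReal_div_of_pos hk', ENNReal.ofReal_sum_of_nonneg fun _ _ =>
      ENNReal.toReal_nonneg, ENNReal.ofReal_natCast,
      ENNReal.le_div_iff_mul_le (Or.inl (by exact_mod_cast hk.ne')) (Or.inl (by simp))]
    refine h.trans_eq (Finset.sum_congr rfl fun b _ => ?_)
    rw [ENNReal.ofReal_toReal (hfin _)]
  have hinf : ∫⁻ S, risk q (H S) ∂π ≤ (⨅ f ∈ F, risk q f) + ENNReal.ofReal a := by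
    rw [← tsub_le_iff_right]
    exact le_iInf₂ fun f hf => tsub_le_iff_right.2 (hrisk f hf)
  calc _ ≤ ENNReal.ofReal ((∑ b, W (T b)) / k) := havg
    _ ≤ ENNReal.ofReal (∫ S, W S ∂π + ε) := ENNReal.ofReal_le_ofReal hmean
    _ = ∫⁻ S, risk q (H S) ∂π + ENNReal.ofReal ε := by
        rw [ENNReal.ofReal_add (integral_nonneg fun _ => ENNReal.toReal_nonneg) hε.le, hWint]
    _ ≤ (⨅ f ∈ F, risk q f) + ENNReal.ofReal a + ENNReal.ofReal ε := by gcongr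
    _ = _ := by rw [add_assoc, ← ENNReal.ofReal_add ha hε.le]

/-- It suffices to have one learner, with a fixed sample size, for each accuracy. -/
lemma learnable_of_forall_accuracy {F : Set (X → ℝ)} {R γ : ℝ}
    (h : ∀ l : ℕ, ∃ (m : ℕ) (A : (Fin m → X × Icc (-R) R) → X → ℝ),
      (∀ S, UniversallyMeasurable (A S)) ∧
      ∀ q : Measure (X × Icc (-R) R), IsProbabilityMeasure q →
        Measure.pi (fun _ : Fin m => q)
          {S | ¬ risk q (A S) ≤ (⨅ f ∈ F, risk q f) + ENNReal.ofReal (γ + 1 / (l + 1))}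
          ≤ ENNReal.ofReal (1 / (l + 1))) :
    Learnable R γ F := by
  classical
  choose m A hA hfail using h
  -- The finest accuracy, at most `n`, that `n` points can afford. If there is none, the value is 0
  -- and the learner below outputs the zero function.
  let lev : ℕ → ℕ := fun n => Nat.findGreatest (fun l => m l ≤ n) n
  refine ⟨fun n S => if hn : m (lev n) ≤ n then A (lev n) fun j => S (Fin.castLE hn j)
    else fun _ => 0, fun n S => ?_, fun ε hε δ hδ => ?_⟩
  · dsimp only
    split_ifs with hn
    · exact hA _ _
    · exact fun q _ => aemeasurable_const
  · obtain ⟨l, hl⟩ := exists_nat_one_div_lt (lt_min hε hδ)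
    refine ⟨max l (m l), fun q hq n hn => ?_⟩
    have hln : l ≤ n := (le_max_left _ _).trans hn
    have hmn : m l ≤ n := (le_max_right _ _).trans hn
    have hlev : l ≤ lev n := Nat.le_findGreatest hln hmn
    have hspec : m (lev n) ≤ n :=
      Nat.findGreatest_spec (P := fun l => m l ≤ n) hln hmn
    have hsmall : (1 : ℝ) / (lev n + 1) ≤ 1 / (l + 1) := by
      apply one_div_le_one_div_of_le (by positivity)
      have : (l : ℝ) ≤ lev n := by exact_mod_cast hlev
      linarith
    have hmp := measurePreserving_pi_comp q (Fin.castLE_injective hspec)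
    have hle := (Measure.le_map_apply hmp.measurable.aemeasurable _).trans
      (hmp.map_eq ▸ hfail (lev n) q hq)
    refine (measure_mono fun S hS => ?_).trans (hle.trans (ENNReal.ofReal_le_ofReal ?_))
    · simp only [mem_ofPred_eq, dif_pos hspec, mem_preimage] at hS ⊢
      refine fun hcon => hS (hcon.trans ?_)
      gcongr
      exact hsmall.trans (hl.le.trans (min_le_left _ _))
    · exact hsmall.trans (hl.le.trans (min_le_right _ _))

theorem learnable_of_fatDim_lt_top {F : Set (X → ℝ)} {R : ℝ}
    (hR : ∀ f ∈ F, ∀ x, f x ∈ Icc (-R) R) (hF : IsMeasurableClass F) {γ : ℝ} (hγ : 0 < γ)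
    (hfat : ∀ γ' : ℝ, γ < γ' → fatDim γ' F < ⊤) : Learnable R (γ / 2) F := by
  refine learnable_of_forall_accuracy fun l => ?_
  set ε : ℝ := 1 / (l + 1) with hε
  have hε0 : 0 < ε := by positivity
  obtain ⟨d, hd⟩ := exists_shatters_bound_of_fatDim_lt_top (hfat (γ + ε / 4) (by linarith))
  -- Half of the margin, `γ / 2 + ε / 8`, together with `η`, `θ` and the bad-sign term, each at most
  -- `ε / 8`, gives `γ / 2 + ε / 2`; averaging over blocks takes the other `ε / 2`.
  set η := ε / 8 with hη
  have hη0 : 0 < η := by positivity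
  set L := ⌈2 * R / η⌉₊ + 1 with hLdef
  have hL : 2 * R ≤ L * η := by
    rw [← div_le_iff₀ hη0, hLdef]
    push_cast
    linarith [Nat.le_ceil (2 * R / η)]
  have hLη : 0 < L * η := by positivity
  have hlim := tendsto_pow_log_mul_exp (2 * L) d
    (show 0 < (ε / 8) ^ 2 / (2 * (L * η) ^ 2) by positivity)
  have hev := (hlim.eventually (gt_mem_nhds (show (0 : ℝ) < ε / 8 / (L * η) by positivity)))
  obtain ⟨t, ht, ht0⟩ := (hev.and (Filter.eventually_gt_atTop 0)).exists
  obtain ⟨H, hH, hHB, hrisk⟩ := exists_learner_expected_risk_le (g := (γ + ε / 4) / 2) hR hF hη0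
    (by positivity) hL (Nat.succ_pos _) ht0 (by rwa [mul_div_cancel₀ _ two_ne_zero])
    (show 0 < ε / 8 by positivity)
  have hbound : (γ + ε / 4) / 2 + η + ε / 8 + L * η * (((t * (2 * L) * 2 + 1 : ℕ) : ℝ)
      ^ (d * (Nat.log 2 (t * (2 * L) + 1) + 1))
      * Real.exp (-((ε / 8) ^ 2 / (2 * (L * η) ^ 2)) * t)) ≤ γ / 2 + ε / 2 := by
    have h1 := mul_le_mul_of_nonneg_left ht.le hLη.le
    rw [mul_div_cancel₀ _ hLη.ne'] at h1
    rw [hη] at *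
    linarith
  obtain ⟨k, hk⟩ := exists_nat_ge ((|R| + L * η + R) ^ 2 / ((ε / 2) ^ 2 * ε))
  have hkB : (|R| + L * η + R) ^ 2 ≤ ((k + 1 : ℕ) : ℝ) * (ε / 2) ^ 2 * ε := by
    rw [div_le_iff₀ (by positivity)] at hk
    push_cast
    have : 0 ≤ (ε / 2) ^ 2 * ε := by positivity
    nlinarith
  -- The sample consists of `k + 1` blocks, each a double sample of `2 * t` points.
  let e := Fintype.equivFin (Fin (k + 1) × (Fin t × Bool))
  refine ⟨_, fun S x => (∑ b : Fin (k + 1), H (fun i => S (e (b, i))) x) / (k + 1 : ℕ),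
    fun S => ?_, fun q hq => ?_⟩
  · have := UniversallyMeasurable.average (h := fun b : Fin (k + 1) => H fun i => S (e (b, i)))
      fun b => hH.comp (φ := fun x => (fun i => S (e (b, i)), x)) (by fun_prop)
    simpa only [Fintype.card_fin] using this
  · have hblock := measure_block_average_risk_gt_le (F := F) hH hHB q (a := γ / 2 + ε / 2)
      (δ := ε) (by positivity) (half_pos hε0) (fun f hf => (hrisk q hq f hf).trans (by gcongr))
      (Nat.succ_pos k) hkB
    have hmp := (measurePreserving_curry q (Fin t × Bool) (Fin (k + 1))).comp
      (measurePreserving_pi_comp q e.injective)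
    have hle := (Measure.le_map_apply hmp.measurable.aemeasurable _).trans
      (hmp.map_eq ▸ hblock)
    rw [show γ / 2 + ε / 2 + ε / 2 = γ / 2 + ε by ring] at hle
    exact hle

end Learnability

theorem theorem1 {X : Type*} [MeasurableSpace X] (R : ℝ) (F : Set (X → ℝ))
    (hR : ∀ f ∈ F, ∀ x, f x ∈ Set.Icc (-R) R) (hF : IsMeasurableClass F)
    (γ : ℝ) (hγ : 0 < γ) :
    List.TFAE [
      Learnable R (γ / 2) F,
      UniformConvergence γ F,
      ∀ γ' : ℝ, γ < γ' → fatDim γ' F < ⊤] := by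
  tfae_have 1 → 3 := fun h _ => fatDim_lt_top_of_learnable hR hF hγ h
  tfae_have 2 → 3 := fun h _ => fatDim_lt_top_of_uniformConvergence hR hF hγ h
  tfae_have 3 → 1 := learnable_of_fatDim_lt_top hR hF hγ
  tfae_have 3 → 2 := uniformConvergence_of_fatDim_lt_top hR hF hγ
  tfae_finish
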